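/- Let $d$ be a dimension, $\alpha\in(0,1)$, $0<T<\infty$, and regard functions on the torus $\mathbb{T}^d=\mathbb{R}^d/\mathbb{Z}^d$ as $\mathbb{Z}^d$-periodic functions on $\mathbb{R}^d$. Put $Q_T=(0,T]\times\mathbb{T}^d$ and $\overline{Q_T}=[0,T]\times\mathbb{T}^d$. Let $b:\overline{Q_T}\to\mathbb{R}^d$ be continuous and $u_0:\mathbb{T}^d\to\mathbb{R}$, and assume that there are constants $C_1,C_2>0$ such that $$|b(t,x)-b(t,y)|\le C_1|x-y|,\qquad |u_0(x)-u_0(y)|\le C_2|x-y|$$ for all $(t,x,y)\in(0,T]\times\mathbb{R}^d\times\mathbb{R}^d$. Consider the initial value problem with Caputo's time-fractional derivative $\partial_t^\alpha$, $$\partial_t^\alpha u+b\cdot Du=0\ \text{ in } Q_T,\qquad u|_{t=0}=u_0\ \text{ in }\mathbb{T}^d. \tag{P}$$ Viscosity solutions are understood as follows. For $t\in(0,T]$ let $$J_r[f](t)=\frac{\alpha}{\Gamma(1-\alpha)}\int_0^r\frac{f(t)-f(t-\tau)}{\tau^{\alpha+1}}\,d\tau,\qquad K_r[f](t)=\frac{f(t)-f(0)}{t^\alpha\Gamma(1-\alpha)}+\frac{\alpha}{\Gamma(1-\alpha)}\int_r^t\frac{f(t)-f(t-\tau)}{\tau^{\alpha+1}}\,d\tau,$$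 applied in the time variable to functions of $(t,x)$. Test functions are the $\phi\in C^1((0,T]\times\mathbb{R}^d)\cap C([0,T]\times\mathbb{R}^d)$ with $\partial_t\phi(\cdot,x)\in L^1(0,T)$ for every $x$. An upper (resp. lower) semicontinuous function $u:\overline{Q_T}\to\mathbb{R}$ is a viscosity subsolution (resp. supersolution) of the equation if for all $a<b'$ in $[0,T]$, all open balls $B\subset\mathbb{R}^d$ and all test functions $\phi$ such that $u-\phi$ attains its maximum (resp. minimum) over $[a,b']\times\overline B$ at a point $(\hat t,\hat x)\in(a,b']\times B$, $$J_{\hat t-a}[\phi](\hat t,\hat x)+K_{\hat t-a}[u](\hat t,\hat x)+b(\hat t,\hat x)\cdot D\phi(\hat t,\hat x)\le0\quad(\text{resp. }\ge0).$$ A viscosity solution of (P) is a function $u\in C(\overline{Q_T})$ that is both a viscosity subsolution and a viscosity supersolution and satisfies $u(0,\cdot)=u_0$. Then (P) has exactly one viscosity solution $u\in C(\overline{Q_T})$. Moreover, there is a constant $C_3>0$ such that $$|u(t,x)-u(s,y)|\le C_3\left(|t-s|^\alpha+|x-y|\right)\qquad\text{for all }(t,x),(s,y)\in[0,T]\times\mathbb{R}^d.$$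 -/

import Mathlib

open MeasureTheory Set

noncomputable section

namespace TimeFractional

/-- The space `ℝ^d` with its Euclidean norm. -/
abbrev Space (d : ℕ) : Type := EuclideanSpace ℝ (Fin d)

/-- A function on the torus `ℝ^d / ℤ^d` is regarded as a `ℤ^d`-periodic function on `ℝ^d`. -/
def IsTorusPeriodic {d : ℕ} {β : Type*} (f : Space d → β) : Prop :=
  ∀ (x : Space d) (z : Fin d → ℤ), f (x + WithLp.toLp 2 (fun i => (z i : ℝ))) = f x

/-- The closed space-time cylinder `[0,T] × ℝ^d`. -/
def closedCylinder (d : ℕ) (T : ℝ) : Set (ℝ × Space d) := Icc 0 T ×ˢ univ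

/-- The half-open space-time cylinder `(0,T] × ℝ^d`. -/
def halfOpenCylinder (d : ℕ) (T : ℝ) : Set (ℝ × Space d) := Ioc 0 T ×ˢ univ

/-- The integrand `τ ↦ (f(t) - f(t-τ)) / τ^(α+1)`. -/
def caputoIntegrand (α : ℝ) (f : ℝ → ℝ) (t τ : ℝ) : ℝ :=
  (f t - f (t - τ)) / τ ^ (α + 1)

/-- `J_r[f](t) = α / Γ(1-α) * ∫_0^r (f(t) - f(t-τ)) dτ / τ^(α+1)`. -/
def J (α r : ℝ) (f : ℝ → ℝ) (t : ℝ) : ℝ :=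
  α / Real.Gamma (1 - α) * ∫ τ in (0 : ℝ)..r, caputoIntegrand α f t τ

/-- `K_r[f](t) = (f(t) - f(0)) / (t^α Γ(1-α)) + α / Γ(1-α) * ∫_r^t (f(t) - f(t-τ)) dτ / τ^(α+1)`. -/
def K (α r : ℝ) (f : ℝ → ℝ) (t : ℝ) : ℝ :=
  (f t - f 0) / (t ^ α * Real.Gamma (1 - α)) +
    α / Real.Gamma (1 - α) * ∫ τ in r..t, caputoIntegrand α f t τ

/-- The class of test functions: continuous on `[0,T] × ℝ^d`, of class `C^1` on `(0,T] × ℝ^d`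
(up to the final time `T`), with `∂_t φ(·,x) ∈ L^1(0,T)` for every `x`. -/
structure IsTestFunction {d : ℕ} (T : ℝ) (φ : ℝ → Space d → ℝ) : Prop where
  continuousOn : ContinuousOn (Function.uncurry φ) (closedCylinder d T)
  contDiffOn : ContDiffOn ℝ 1 (Function.uncurry φ) (halfOpenCylinder d T)
  integrableOn : ∀ x, IntegrableOn (deriv fun t => φ t x) (Ioo 0 T) volume

/-- Viscosity subsolutions on `(0,T] × 𝕋^d` of `∂_t^α u + H(t, x, u, Du) = 0`. For an upper
semicontinuous `u`, the integral in `K_r[u]`, `r > 0`, is either finite or equal to `+∞`, and in the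
latter case the inequality fails: this is why the integrability is a part of it. It is automatic
if `u` is continuous. -/
structure IsViscositySubsolution {d : ℕ} (α T : ℝ) (H : ℝ → Space d → ℝ → Space d → ℝ)
    (u : ℝ → Space d → ℝ) : Prop where
  periodic : ∀ t ∈ Icc 0 T, IsTorusPeriodic (u t)
  upperSemicontinuousOn : UpperSemicontinuousOn (Function.uncurry u) (closedCylinder d T)
  test : ∀ (a b : ℝ), a ∈ Icc 0 T → b ∈ Icc 0 T → a < b →
    ∀ (c : Space d) (ρ : ℝ), 0 < ρ →
    ∀ φ : ℝ → Space d → ℝ, IsTestFunction T φ →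
    ∀ t ∈ Ioc a b, ∀ x ∈ Metric.ball c ρ,
      (∀ s ∈ Icc a b, ∀ y ∈ Metric.closedBall c ρ, u s y - φ s y ≤ u t x - φ t x) →
      IntervalIntegrable (caputoIntegrand α (fun s => u s x) t) volume (t - a) t ∧
      J α (t - a) (fun s => φ s x) t + K α (t - a) (fun s => u s x) t
        + H t x (u t x) (gradient (φ t) x) ≤ 0

/-- Viscosity supersolutions on `(0,T] × 𝕋^d` of `∂_t^α u + H(t, x, u, Du) = 0`. For a lower
semicontinuous `u`, the integral in `K_r[u]`, `r > 0`, is either finite or equal to `-∞`, and in the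
latter case the inequality fails: this is why the integrability is a part of it. It is automatic
if `u` is continuous. -/
structure IsViscositySupersolution {d : ℕ} (α T : ℝ) (H : ℝ → Space d → ℝ → Space d → ℝ)
    (u : ℝ → Space d → ℝ) : Prop where
  periodic : ∀ t ∈ Icc 0 T, IsTorusPeriodic (u t)
  lowerSemicontinuousOn : LowerSemicontinuousOn (Function.uncurry u) (closedCylinder d T)
  test : ∀ (a b : ℝ), a ∈ Icc 0 T → b ∈ Icc 0 T → a < b →
    ∀ (c : Space d) (ρ : ℝ), 0 < ρ →
    ∀ φ : ℝ → Space d → ℝ, IsTestFunction T φ →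
    ∀ t ∈ Ioc a b, ∀ x ∈ Metric.ball c ρ,
      (∀ s ∈ Icc a b, ∀ y ∈ Metric.closedBall c ρ, u t x - φ t x ≤ u s y - φ s y) →
      IntervalIntegrable (caputoIntegrand α (fun s => u s x) t) volume (t - a) t ∧
      0 ≤ J α (t - a) (fun s => φ s x) t + K α (t - a) (fun s => u s x) t
        + H t x (u t x) (gradient (φ t) x)

/-- Viscosity solutions `u ∈ C([0,T] × 𝕋^d)` of the initial value problem
`∂_t^α u + H(t, x, u, Du) = 0`, `u(0,·) = u₀`. -/
structure IsViscositySolution {d : ℕ} (α T : ℝ) (H : ℝ → Space d → ℝ → Space d → ℝ)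
    (u₀ : Space d → ℝ) (u : ℝ → Space d → ℝ) : Prop where
  continuousOn : ContinuousOn (Function.uncurry u) (closedCylinder d T)
  subsolution : IsViscositySubsolution α T H u
  supersolution : IsViscositySupersolution α T H u
  initial : ∀ x, u 0 x = u₀ x

/-- The Hamiltonian `H(t,x,r,p) = b(t,x) · p` of the transport equation
`∂_t^α u + b · Du = 0`. -/
def transportHamiltonian {d : ℕ} (b : ℝ → Space d → Space d) :
    ℝ → Space d → ℝ → Space d → ℝ :=
  fun t x _ p => inner ℝ (b t x) p

end TimeFractional

end

namespace TimeFractional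
open Filter Topology

/-! Existence comes from an explicit monotone scheme. With time step h and a_k = (k+1)^(-α), the
Caputo derivative at t_{n+1}, multiplied by Γ(1-α) h^α, becomes U_{n+1} minus a weighted average of
U_n, …, U_0. The scheme sets U_{n+1}(x) equal to that average taken at the foot x - Γ(1-α) h^α
b(t_{n+1}, x).

The delicate point is stability: feet move by order h^α while there are T/h steps, so a step-by-step
Grönwall bound blows up. The resolvent q, defined by q * a = 1, recovers X_n - X_0 from the defects
X_{j+1} - (average of X_j, …, X_0). Log-convexity of a makes q nonincreasing (Kaluza), and the sum
of q_i over i < n is at most n^α. Since h^α n^α = (nh)^α, this gives bounds uniform in h: Lipschitz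
in space (`growth_le`) and α-Hölder in time (`abs_sub_le_sum_resolvent`).

These bounds yield a limit along an ultrafilter with the same modulus of continuity
(`exists_isSchemeLimit`). Monotonicity and consistency of the scheme make it a viscosity solution
(`IsSchemeLimit.eventually_K_le`, `J_add_K_le`).

For uniqueness, `comparison_of_lipschitz` doubles the variables. If one function is Lipschitz in
space, the penalty gradient (x-y)/ε stays bounded, so the two transport terms cancel in the limit by
continuity of b, and the Caputo terms say that u - v at its maximum does not exceed its initial
value. The constructed solution is Lipschitz, so every solution can be compared with it from both
sides; its Hölder bound is then the bound for the unique solution. -/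

/-! ### Memory averages. -/

/-- The average of the history `X n, …, X 0` with tail weights `a`. -/
def memoryAverage (a X : ℕ → ℝ) (n : ℕ) : ℝ :=
  ∑ k ∈ Finset.range n, (a k - a (k + 1)) * X (n - k) + a n * X 0

/-- Admissible tail weights: positive, nonincreasing, log-convex, normalized. -/
structure IsMemoryKernel (a : ℕ → ℝ) : Prop where
  zero : a 0 = 1
  pos : ∀ n, 0 < a n
  antitone : Antitone a
  logConvex : ∀ n, a (n + 1) * a (n + 1) ≤ a n * a (n + 2)

/-- The resolvent sequence `q` of `a`, determined by `∑_{j ≤ n} q j * a (n - j) = 1`. -/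
noncomputable def resolvent (a : ℕ → ℝ) (n : ℕ) : ℝ :=
  PowerSeries.coeff n ((PowerSeries.mk a)⁻¹ * PowerSeries.mk fun _ => 1)

theorem memoryAverage_const {a : ℕ → ℝ} (ha : a 0 = 1) (c : ℝ) (n : ℕ) :
    memoryAverage a (fun _ => c) n = c := by
  have h := Finset.sum_range_sub' a n
  rw [memoryAverage, ← Finset.sum_mul, h, ha]; ring

theorem memoryAverage_mono {a : ℕ → ℝ} (ha : IsMemoryKernel a) {X Y : ℕ → ℝ} {n : ℕ}
    (h : ∀ k ≤ n, X k ≤ Y k) : memoryAverage a X n ≤ memoryAverage a Y n := by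
  unfold memoryAverage
  refine add_le_add (Finset.sum_le_sum fun k _ => ?_) ?_
  · exact mul_le_mul_of_nonneg_left (h _ (Nat.sub_le _ _))
      (sub_nonneg.2 (ha.antitone (Nat.le_succ k)))
  · exact mul_le_mul_of_nonneg_left (h _ (Nat.zero_le _)) (ha.pos n).le

theorem memoryAverage_sub (a X Y : ℕ → ℝ) (n : ℕ) :
    memoryAverage a (fun k => X k - Y k) n = memoryAverage a X n - memoryAverage a Y n := by
  simp only [memoryAverage, mul_sub, Finset.sum_sub_distrib]; ring

theorem memoryAverage_mul (a X : ℕ → ℝ) (c : ℝ) (n : ℕ) :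
    memoryAverage a (fun k => X k * c) n = memoryAverage a X n * c := by
  simp only [memoryAverage, add_mul, Finset.sum_mul, mul_assoc]

theorem abs_memoryAverage_sub_le {a : ℕ → ℝ} (ha : IsMemoryKernel a) {X Y Z : ℕ → ℝ} {n : ℕ}
    (h : ∀ k ≤ n, |X k - Y k| ≤ Z k) :
    |memoryAverage a X n - memoryAverage a Y n| ≤ memoryAverage a Z n := by
  rw [abs_le, ← memoryAverage_sub]
  constructor
  · have := memoryAverage_mul a Z (-1) n
    simp only [mul_neg, mul_one] at this
    rw [← this]
    exact memoryAverage_mono ha fun k hk => (abs_le.1 (h k hk)).1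
  · exact memoryAverage_mono ha fun k hk => (abs_le.1 (h k hk)).2

/-- Summation by parts. The convolution form allows the defect to be inverted by power series. -/
theorem sub_memoryAverage {a : ℕ → ℝ} (ha : a 0 = 1) (X : ℕ → ℝ) (n : ℕ) :
    X (n + 1) - memoryAverage a X n =
      ∑ p ∈ Finset.HasAntidiagonal.antidiagonal n, a p.1 * (X (p.2 + 1) - X p.2) := by
  rw [Finset.Nat.sum_antidiagonal_eq_sum_range_succ
    (f := fun i j => a i * (X (j + 1) - X j))]
  have h1 : ∑ k ∈ Finset.range (n + 1), a k * X (n - k + 1)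
      = X (n + 1) + ∑ k ∈ Finset.range n, a (k + 1) * X (n - k) := by
    rw [Finset.sum_range_succ', add_comm, ha, one_mul, Nat.sub_zero]
    congr 1
    refine Finset.sum_congr rfl fun k hk => ?_
    have := Finset.mem_range.1 hk
    rw [show n - (k + 1) + 1 = n - k by omega]
  simp only [mul_sub, Finset.sum_sub_distrib, h1, memoryAverage, sub_mul]
  rw [Finset.sum_range_succ, Nat.sub_self]; ring

/-! ### The resolvent sequence and discrete fractional Grönwall estimates. -/

section resolvent
variable {a : ℕ → ℝ} (ha : IsMemoryKernel a)
include ha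

theorem constantCoeff_kernel_ne : PowerSeries.constantCoeff (PowerSeries.mk a) ≠ 0 := by
  rw [← PowerSeries.coeff_zero_eq_constantCoeff_apply, PowerSeries.coeff_mk, ha.zero]
  exact one_ne_zero

theorem sum_resolvent_mul (n : ℕ) :
    ∑ p ∈ Finset.HasAntidiagonal.antidiagonal n, resolvent a p.1 * a p.2 = 1 := by
  have h : ((PowerSeries.mk a)⁻¹ * PowerSeries.mk fun _ => (1 : ℝ)) * PowerSeries.mk a
      = PowerSeries.mk fun _ => 1 := by
    rw [mul_right_comm, PowerSeries.inv_mul_cancel _ (constantCoeff_kernel_ne ha), one_mul]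
  have := congrArg (PowerSeries.coeff n) h
  simpa [PowerSeries.coeff_mul, resolvent] using this

/-- The series of defects is a · ΔX; multiplying by a⁻¹/(1-z) leaves ΔX/(1-z), whose coefficients
are telescoping sums of increments. -/
theorem sub_zero_eq_sum_resolvent (X : ℕ → ℝ) (n : ℕ) :
    X (n + 1) - X 0 =
      ∑ p ∈ Finset.HasAntidiagonal.antidiagonal n, resolvent a p.1 * (X (p.2 + 1) - memoryAverage a X p.2) := by
  let D : PowerSeries ℝ := PowerSeries.mk fun j => X (j + 1) - X j
  have hG : (PowerSeries.mk fun j => X (j + 1) - memoryAverage a X j)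
      = PowerSeries.mk a * D := by
    ext j
    rw [PowerSeries.coeff_mk, sub_memoryAverage ha.zero, PowerSeries.coeff_mul]
    simp [D]
  have h : ((PowerSeries.mk a)⁻¹ * PowerSeries.mk fun _ => (1 : ℝ)) *
      (PowerSeries.mk fun j => X (j + 1) - memoryAverage a X j)
      = (PowerSeries.mk fun _ => 1) * D := by
    rw [hG, mul_right_comm, ← mul_assoc,
      PowerSeries.inv_mul_cancel _ (constantCoeff_kernel_ne ha), one_mul, mul_comm]
  have h2 := congrArg (PowerSeries.coeff n) h
  rw [PowerSeries.coeff_mul, PowerSeries.coeff_mul] at h2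
  simp only [PowerSeries.coeff_mk, D, one_mul] at h2
  rw [show (∑ p ∈ Finset.HasAntidiagonal.antidiagonal n, (X (p.2 + 1) - X p.2)) = X (n + 1) - X 0 by
    rw [Finset.Nat.sum_antidiagonal_eq_sum_range_succ_mk]
    exact (Finset.sum_range_reflect (fun j => X (j + 1) - X j) (n + 1)).trans
      (Finset.sum_range_sub X (n + 1))] at h2
  exact h2.symm

/-- Kaluza's theorem. -/
theorem coeff_succ_inv_kernel_nonpos (n : ℕ) :
    PowerSeries.coeff (n + 1) (PowerSeries.mk a)⁻¹ ≤ 0 := by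
  set c : ℕ → ℝ := fun n => PowerSeries.coeff n (PowerSeries.mk a)⁻¹ with hc
  have hconv : ∀ n, ∑ k ∈ Finset.range (n + 1), c (k + 1) * a (n - k) = - a (n + 1) := by
    intro n
    have h := congrArg (PowerSeries.coeff (n + 1))
      (PowerSeries.inv_mul_cancel _ (constantCoeff_kernel_ne ha))
    rw [PowerSeries.coeff_mul, Finset.Nat.sum_antidiagonal_eq_sum_range_succ
      (f := fun i j => PowerSeries.coeff i (PowerSeries.mk a)⁻¹ *
        PowerSeries.coeff j (PowerSeries.mk a)), Finset.sum_range_succ'] at h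
    have h0 : c 0 = 1 := by
      have h := PowerSeries.coeff_zero_eq_constantCoeff_apply (PowerSeries.mk a)⁻¹
      rw [PowerSeries.constantCoeff_inv, ← PowerSeries.coeff_zero_eq_constantCoeff_apply,
        PowerSeries.coeff_mk, ha.zero, inv_one] at h
      exact h
    simp only [PowerSeries.coeff_mk, PowerSeries.coeff_one, Nat.succ_ne_zero, if_false,
      Nat.sub_zero, Nat.add_sub_add_right] at h
    change (∑ k ∈ Finset.range (n + 1), c (k + 1) * a (n - k)) + c 0 * a (n + 1) = 0 at h
    rw [h0] at h; linarith
  -- Iterated log-convexity: the ratio a (i+1) / a i is nondecreasing in i.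
  have hratio : ∀ i d, a (i + 1) * a (i + d) ≤ a i * a (i + d + 1) := by
    intro i d
    induction d with
    | zero => simp [mul_comm]
    | succ d ih =>
      have h1 := ha.logConvex (i + d)
      have p1 := ha.pos (i + d)
      have p2 := ha.pos (i + d + 1)
      have p3 := ha.pos i
      have p4 := ha.pos (i + 1)
      rw [show i + (d + 1) = i + d + 1 by ring]
      have : a (i + d) * (a (i + 1) * a (i + d + 1)) ≤ a (i + d) * (a i * a (i + d + 2)) := by
        nlinarith [mul_le_mul_of_nonneg_right ih p2.le, mul_le_mul_of_nonneg_left h1 p3.le]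
      exact le_of_mul_le_mul_left this p1
  change c (n + 1) ≤ 0
  induction n using Nat.strong_induction_on with
  | _ n ih =>
    rcases n with _ | n
    · have := hconv 0
      simp [ha.zero] at this
      rw [zero_add, this]; linarith [ha.pos 1]
    · have e1 := hconv n
      have e2 := hconv (n + 1)
      rw [Finset.sum_range_succ, Nat.sub_self, ha.zero, mul_one] at e2
      -- The earlier coefficients are nonpositive, so replacing the ratio a (n+1-k) / a (n-k) by the
      -- larger a (n+2) / a (n+1) lowers the sum, which the convolution identity at n then
      -- evaluates.
      have key : ∑ k ∈ Finset.range (n + 1), c (k + 1) * a (n + 1 - k) * a (n + 1) ≥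
          ∑ k ∈ Finset.range (n + 1), c (k + 1) * a (n - k) * a (n + 2) := by
        refine Finset.sum_le_sum fun k hk => ?_
        have hk' := Finset.mem_range.1 hk
        have hck := ih k hk'
        have := hratio (n - k) (k + 1)
        rw [show n - k + 1 = n + 1 - k by omega, show n - k + (k + 1) = n + 1 by omega] at this
        nlinarith
      rw [← Finset.sum_mul, ← Finset.sum_mul, e1] at key
      have hp := ha.pos (n + 1)
      have : (∑ k ∈ Finset.range (n + 1), c (k + 1) * a (n + 1 - k)) ≥ - a (n + 2) := by
        nlinarith
      linarith

/-- The factor 1/(1-z) takes partial sums, so the increments of q are coefficients of a⁻¹ of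
positive index, nonpositive by Kaluza's theorem. -/
theorem resolvent_antitone : Antitone (resolvent a) := by
  refine antitone_nat_of_succ_le fun n => ?_
  have h : ∀ n, resolvent a n = ∑ k ∈ Finset.range (n + 1), PowerSeries.coeff k (PowerSeries.mk a)⁻¹ := by
    intro n
    rw [resolvent, PowerSeries.coeff_mul, Finset.Nat.sum_antidiagonal_eq_sum_range_succ_mk]
    simp
  rw [h, h, Finset.sum_range_succ]
  linarith [coeff_succ_inv_kernel_nonpos ha n]

/-- Compare q * a = 1 at n and n + 1: since a is nonincreasing, the terms in q 0, …, q n total at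
most 1 at index n + 1, and q (n+1) makes up the difference. -/
theorem resolvent_nonneg (n : ℕ) : 0 ≤ resolvent a n := by
  induction n using Nat.strong_induction_on with
  | _ n ih =>
    rcases n with _ | n
    · have := sum_resolvent_mul ha 0
      simp [ha.zero] at this
      rw [this]; exact zero_le_one
    · have e1 := sum_resolvent_mul ha n
      have e2 := sum_resolvent_mul ha (n + 1)
      rw [Finset.Nat.sum_antidiagonal_eq_sum_range_succ (f := fun i j => resolvent a i * a j)]
        at e1 e2
      rw [Finset.sum_range_succ, Nat.sub_self, ha.zero, mul_one] at e2
      have : ∑ k ∈ Finset.range (n + 1), resolvent a k * a (n + 1 - k) ≤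
          ∑ k ∈ Finset.range (n + 1), resolvent a k * a (n - k) :=
        Finset.sum_le_sum fun k hk => mul_le_mul_of_nonneg_left (ha.antitone (by omega))
          (ih k (Finset.mem_range.1 hk))
      linarith

theorem sum_resolvent_le (n : ℕ) : (∑ i ∈ Finset.range (n + 1), resolvent a i) * a n ≤ 1 := by
  have e1 := sum_resolvent_mul ha n
  rw [Finset.Nat.sum_antidiagonal_eq_sum_range_succ (f := fun i j => resolvent a i * a j)] at e1
  rw [← e1, Finset.sum_mul]
  exact Finset.sum_le_sum fun k _ => mul_le_mul_of_nonneg_left (ha.antitone (Nat.sub_le _ _))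
    (resolvent_nonneg ha k)

theorem sub_zero_eq_sum_range_resolvent (X : ℕ → ℝ) (n : ℕ) :
    X n - X 0 =
      ∑ j ∈ Finset.range n, resolvent a j * (X (n - j) - memoryAverage a X (n - 1 - j)) := by
  rcases n with _ | n
  · simp
  · rw [sub_zero_eq_sum_resolvent ha X n, Finset.Nat.sum_antidiagonal_eq_sum_range_succ_mk]
    refine Finset.sum_congr rfl fun j hj => ?_
    have := Finset.mem_range.1 hj
    rw [show n + 1 - j = n - j + 1 by omega, show n + 1 - 1 - j = n - j by omega]

/-- On the common history, monotonicity of q gives the differences q (n-1-j) - q (m-1-j) one sign,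
and their absolute values telescope to at most the sum of the first n - m terms of q. The defects
after time m contribute the same amount, whence the factor 2. -/
theorem abs_sub_le_sum_resolvent {X : ℕ → ℝ} {M : ℝ} {n : ℕ}
    (hX : ∀ j < n, |X (j + 1) - memoryAverage a X j| ≤ M) {m : ℕ} (hm : m ≤ n) :
    |X n - X m| ≤ 2 * M * ∑ i ∈ Finset.range (n - m), resolvent a i := by
  rcases Nat.eq_zero_or_pos n with rfl | hn
  · obtain rfl : m = 0 := by omega
    simp
  have hM : 0 ≤ M := (abs_nonneg _).trans (hX 0 hn)
  obtain ⟨d, rfl⟩ := Nat.exists_eq_add_of_le hm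
  set q := resolvent a
  set G : ℕ → ℝ := fun j => X (j + 1) - memoryAverage a X j
  have hsum : ∀ k, X k - X 0 = ∑ j ∈ Finset.range k, q (k - 1 - j) * G j := by
    intro k
    rw [sub_zero_eq_sum_range_resolvent ha X k, ← Finset.sum_range_reflect]
    refine Finset.sum_congr rfl fun j hj => ?_
    have := Finset.mem_range.1 hj
    rw [show k - (k - 1 - j) = j + 1 by omega, show k - 1 - (k - 1 - j) = j by omega]
  have e : X (m + d) - X m = ∑ j ∈ Finset.range m, (q (m + d - 1 - j) - q (m - 1 - j)) * G j +
      ∑ j ∈ Finset.range d, q (d - 1 - j) * G (m + j) := by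
    have h1 := hsum (m + d)
    have h2 := hsum m
    rw [Finset.sum_range_add] at h1
    have h3 : ∑ j ∈ Finset.range d, q (m + d - 1 - (m + j)) * G (m + j) =
        ∑ j ∈ Finset.range d, q (d - 1 - j) * G (m + j) :=
      Finset.sum_congr rfl fun j _ => by rw [show m + d - 1 - (m + j) = d - 1 - j by omega]
    rw [h3] at h1
    simp only [sub_mul, Finset.sum_sub_distrib]
    linarith
  have b1 : |∑ j ∈ Finset.range m, (q (m + d - 1 - j) - q (m - 1 - j)) * G j| ≤
      ∑ j ∈ Finset.range m, (q (m - 1 - j) - q (m + d - 1 - j)) * M := by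
    refine (Finset.abs_sum_le_sum_abs _ _).trans (Finset.sum_le_sum fun j hj => ?_)
    have := Finset.mem_range.1 hj
    have hq : q (m + d - 1 - j) ≤ q (m - 1 - j) := resolvent_antitone ha (by omega)
    rw [abs_mul, abs_of_nonpos (by linarith), neg_sub]
    exact mul_le_mul_of_nonneg_left (hX j (by omega)) (by linarith)
  have b2 : |∑ j ∈ Finset.range d, q (d - 1 - j) * G (m + j)| ≤ ∑ j ∈ Finset.range d, q (d - 1 - j) * M := by
    refine (Finset.abs_sum_le_sum_abs _ _).trans (Finset.sum_le_sum fun j hj => ?_)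
    have := Finset.mem_range.1 hj
    have hq : 0 ≤ q (d - 1 - j) := resolvent_nonneg ha _
    rw [abs_mul, abs_of_nonneg hq]
    exact mul_le_mul_of_nonneg_left (hX (m + j) (by omega)) hq
  have s1 : ∑ j ∈ Finset.range d, q (d - 1 - j) = ∑ j ∈ Finset.range d, q j := Finset.sum_range_reflect q d
  have s2 : ∑ j ∈ Finset.range m, q (m - 1 - j) = ∑ j ∈ Finset.range m, q j := Finset.sum_range_reflect q m
  have s3 : ∑ j ∈ Finset.range m, q (m + d - 1 - j) = ∑ j ∈ Finset.range m, q (d + j) := by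
    rw [← Finset.sum_range_reflect]
    refine Finset.sum_congr rfl fun j hj => ?_
    have := Finset.mem_range.1 hj
    rw [show m + d - 1 - (m - 1 - j) = d + j by omega]
  have s4 : ∑ j ∈ Finset.range m, q j + ∑ j ∈ Finset.range d, q (m + j)
      = ∑ j ∈ Finset.range d, q j + ∑ j ∈ Finset.range m, q (d + j) := by
    rw [← Finset.sum_range_add, ← Finset.sum_range_add, add_comm]
  have s5 : 0 ≤ ∑ j ∈ Finset.range d, q (m + j) := Finset.sum_nonneg fun _ _ => resolvent_nonneg ha _
  rw [← Finset.sum_mul, Finset.sum_sub_distrib, s2, s3] at b1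
  rw [← Finset.sum_mul, s1] at b2
  rw [e, Nat.add_sub_cancel_left]
  refine (abs_add_le _ _).trans ((add_le_add b1 b2).trans ?_)
  nlinarith

/-- Since q (N+i) ≤ q i, the tail beyond N is at most z^N times the whole sum and can be absorbed.
-/
theorem sum_resolvent_mul_pow_le {z : ℝ} (hz₀ : 0 ≤ z) (hz₁ : z ≤ 1) (N n : ℕ) :
    (∑ i ∈ Finset.range n, resolvent a i * z ^ i) * (1 - z ^ N) ≤ ∑ i ∈ Finset.range N, resolvent a i := by
  have h1 : ∑ i ∈ Finset.range n, resolvent a i * z ^ i ≤ ∑ i ∈ Finset.range (N + n), resolvent a i * z ^ i :=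
    Finset.sum_le_sum_of_subset_of_nonneg (Finset.range_mono (by omega)) fun i _ _ =>
      mul_nonneg (resolvent_nonneg ha i) (pow_nonneg hz₀ i)
  rw [Finset.sum_range_add] at h1
  have h2 : ∑ i ∈ Finset.range n, resolvent a (N + i) * z ^ (N + i) ≤
      z ^ N * ∑ i ∈ Finset.range n, resolvent a i * z ^ i := by
    rw [Finset.mul_sum]
    refine Finset.sum_le_sum fun i _ => ?_
    rw [pow_add, mul_left_comm]
    exact mul_le_mul_of_nonneg_left (mul_le_mul_of_nonneg_right
      (resolvent_antitone ha (by omega)) (pow_nonneg hz₀ i)) (pow_nonneg hz₀ N)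
  have h3 : ∑ i ∈ Finset.range N, resolvent a i * z ^ i ≤ ∑ i ∈ Finset.range N, resolvent a i :=
    Finset.sum_le_sum fun i _ => mul_le_of_le_one_right (resolvent_nonneg ha i)
      (pow_le_one₀ hz₀ hz₁)
  nlinarith

/-- A discrete fractional Grönwall inequality. -/
theorem growth_le {κ : ℝ} (hκ : 0 ≤ κ) {X : ℕ → ℝ} (h₀ : 0 ≤ X 0)
    (hX : ∀ n, X (n + 1) = (1 + κ) * memoryAverage a X n) {N : ℕ}
    (hN : κ * ∑ i ∈ Finset.range N, resolvent a i ≤ 1 / 4) {z : ℝ} (hz₀ : 0 < z) (hz₁ : z ≤ 1)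
    (hzN : z ^ N ≤ 1 / 2) (n : ℕ) : X n * z ^ n ≤ 2 * X 0 := by
  induction n using Nat.strong_induction_on with
  | _ n ih =>
    rcases n with _ | n
    · simp; linarith
    -- Since z ^ j ≤ z ^ k for k ≤ j, the weighted bound passes from the values to their averages.
    have hav : ∀ j ≤ n, memoryAverage a X j * z ^ j ≤ 2 * X 0 := by
      intro j hj
      rw [← memoryAverage_mul]
      calc _ ≤ memoryAverage a (fun _ => 2 * X 0) j := by
            refine memoryAverage_mono ha fun k hk => ?_
            by_cases hx : 0 ≤ X k
            · exact (mul_le_mul_of_nonneg_left (pow_le_pow_of_le_one hz₀.le hz₁ hk) hx).trans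
                (ih k (by omega))
            · nlinarith [pow_pos hz₀ j]
        _ = _ := memoryAverage_const ha.zero _ _
    have h1 := sub_zero_eq_sum_range_resolvent ha X (n + 1)
    have h2 : (∑ j ∈ Finset.range (n + 1), resolvent a j *
        (X (n + 1 - j) - memoryAverage a X (n + 1 - 1 - j))) * z ^ (n + 1) ≤
        κ * (2 * X 0) * ∑ j ∈ Finset.range (n + 1), resolvent a j * z ^ j := by
      rw [Finset.sum_mul, Finset.mul_sum]
      refine Finset.sum_le_sum fun j hj => ?_
      have hj' := Finset.mem_range.1 hj
      rw [show n + 1 - j = n - j + 1 by omega, hX, show n + 1 - 1 - j = n - j by omega]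
      have hm := hav (n - j) (by omega)
      have e : z ^ (n + 1) = z ^ j * z ^ (n - j) * z := by
        rw [← pow_add, ← pow_succ]; congr 1; omega
      have hq := resolvent_nonneg ha j
      have hzj := pow_pos hz₀ j
      have h3 : memoryAverage a X (n - j) * z ^ (n - j) * z ≤ 2 * X 0 := by
        nlinarith
      calc _ = resolvent a j * z ^ j * κ * (memoryAverage a X (n - j) * z ^ (n - j) * z) := by
            rw [e]; ring
        _ ≤ resolvent a j * z ^ j * κ * (2 * X 0) :=
            mul_le_mul_of_nonneg_left h3 (by positivity)
        _ = _ := by ring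
    have h4 := sum_resolvent_mul_pow_le ha hz₀.le hz₁ N (n + 1)
    have h5 : 0 ≤ ∑ j ∈ Finset.range (n + 1), resolvent a j * z ^ j :=
      Finset.sum_nonneg fun i _ => mul_nonneg (resolvent_nonneg ha i) (pow_pos hz₀ i).le
    -- This is (1/4) / (1 - 1/2). The bound 2 * X 0 then reproduces itself as X 0 + (1/2)(2 * X 0).
    have h6 : κ * ∑ j ∈ Finset.range (n + 1), resolvent a j * z ^ j ≤ 1 / 2 := by nlinarith
    have h7 : z ^ (n + 1) ≤ 1 := pow_le_one₀ hz₀.le hz₁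
    rw [← h1] at h2
    nlinarith

end resolvent

/-! ### The Caputo weights, the scheme and its stability. -/

/-- The memory kernel of the Caputo derivative of order `α`. -/
noncomputable def caputoKernel (α : ℝ) (n : ℕ) : ℝ := ((n : ℝ) + 1) ^ (-α)

theorem isMemoryKernel_caputoKernel {α : ℝ} (hα : 0 < α) : IsMemoryKernel (caputoKernel α) where
  zero := by simp [caputoKernel]
  pos n := by unfold caputoKernel; positivity
  antitone := fun m n h => by
    have : (m : ℝ) ≤ n := by exact_mod_cast h
    exact Real.rpow_le_rpow_of_nonpos (by positivity) (by linarith) (by linarith)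
  logConvex n := by
    unfold caputoKernel
    push_cast
    rw [← Real.mul_rpow (by positivity) (by positivity),
      ← Real.mul_rpow (by positivity) (by positivity)]
    exact Real.rpow_le_rpow_of_nonpos (by positivity) (by nlinarith) (by linarith)

theorem sum_resolvent_caputoKernel_le {α : ℝ} (hα : 0 < α) (n : ℕ) :
    ∑ i ∈ Finset.range n, resolvent (caputoKernel α) i ≤ (n : ℝ) ^ α := by
  rcases n with _ | n
  · simp [Real.zero_rpow hα.ne']
  · have := sum_resolvent_le (isMemoryKernel_caputoKernel hα) n
    rw [caputoKernel, Real.rpow_neg (by positivity), ← div_eq_mul_inv,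
      div_le_one (by positivity)] at this
    exact_mod_cast this

/-- The explicit monotone scheme with memory kernel `a` and feet of characteristics `Y`. -/
def scheme {E : Type*} (a : ℕ → ℝ) (c : ℝ) (Y : ℕ → E → E) (g : E → ℝ) : ℕ → E → ℝ
  | 0, x => g x
  | n + 1, x => c * (∑ k ∈ Finset.range n, (a k - a (k + 1)) * scheme a c Y g (n - k) (Y (n + 1) x)
      + a n * g (Y (n + 1) x))
  decreasing_by omega

section scheme
variable {E : Type*} (a : ℕ → ℝ) (c : ℝ) (Y : ℕ → E → E) (g : E → ℝ)

theorem scheme_zero : scheme a c Y g 0 = g := by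
  funext x; rw [scheme]

theorem scheme_succ (n : ℕ) (x : E) : scheme a c Y g (n + 1) x =
    c * memoryAverage a (fun k => scheme a c Y g k (Y (n + 1) x)) n := by
  rw [scheme, memoryAverage, scheme_zero]

/-- Serves to transfer invariance under lattice translations to the scheme. -/
theorem scheme_comp_eq {σ : E → E} (hY : ∀ n x, Y n (σ x) = σ (Y n x))
    (hg : ∀ x, g (σ x) = g x) (n : ℕ) (x : E) :
    scheme a c Y g n (σ x) = scheme a c Y g n x := by
  induction n using Nat.strong_induction_on generalizing x with
  | _ n ih =>
    rcases n with _ | n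
    · simp [scheme_zero, hg]
    · rw [scheme_succ, scheme_succ, hY]
      congr 1
      unfold memoryAverage
      congr 1
      · refine Finset.sum_congr rfl fun k _ => ?_
        simp only [ih (n - k) (by omega)]
      · simp only [ih 0 (by omega)]

end scheme

section estimates
variable {E : Type*} [NormedAddCommGroup E] {a : ℕ → ℝ} (ha : IsMemoryKernel a) {Y : ℕ → E → E}
  {g : E → ℝ} {κ C : ℝ}
include ha

/-- The Lipschitz constants obey the recursion of the scheme itself with amplification 1 + κ and no
space variable; hence the instance over `Unit`. -/
theorem scheme_lipschitz (hκ : 0 ≤ κ) (hY : ∀ n x y, ‖Y (n + 1) x - Y (n + 1) y‖ ≤ (1 + κ) * ‖x - y‖)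
    (hg : ∀ x y, |g x - g y| ≤ C * ‖x - y‖) (hC : 0 ≤ C) (n : ℕ) :
    0 ≤ scheme a (1 + κ) (fun _ => id) (fun _ : Unit => C) n () ∧
    ∀ x y, |scheme a 1 Y g n x - scheme a 1 Y g n y| ≤
      scheme a (1 + κ) (fun _ => id) (fun _ : Unit => C) n () * ‖x - y‖ := by
  induction n using Nat.strong_induction_on with
  | _ n ih =>
    rcases n with _ | n
    · simpa [scheme_zero, hC] using hg
    · have h0 : 0 ≤ memoryAverage a
          (fun k => scheme a (1 + κ) (fun _ => id) (fun _ : Unit => C) k ()) n := by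
        rw [← memoryAverage_const ha.zero 0 n]
        exact memoryAverage_mono ha fun k hk => (ih k (by omega)).1
      simp only [scheme_succ, id, one_mul]
      refine ⟨by positivity, fun x y => ?_⟩
      refine (abs_memoryAverage_sub_le ha fun k hk => (ih k (by omega)).2 _ _).trans ?_
      rw [memoryAverage_mul, mul_comm (1 + κ), mul_assoc]
      exact mul_le_mul_of_nonneg_left (hY n x y) h0

/-- The new value is the average at the foot, within ρ of x, so the defect at fixed x is at most L *
ρ. -/
theorem scheme_time_estimate {L ρ : ℝ} {n : ℕ} (hY : ∀ j x, ‖Y (j + 1) x - x‖ ≤ ρ)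
    (hL₀ : 0 ≤ L) (hL : ∀ j ≤ n, ∀ x y, |scheme a 1 Y g j x - scheme a 1 Y g j y| ≤ L * ‖x - y‖)
    {m : ℕ} (hm : m ≤ n) (x : E) :
    |scheme a 1 Y g n x - scheme a 1 Y g m x| ≤
      2 * (L * ρ) * ∑ i ∈ Finset.range (n - m), resolvent a i := by
  refine abs_sub_le_sum_resolvent ha (X := fun j => scheme a 1 Y g j x) (fun j hj => ?_) hm
  simp only [scheme_succ, one_mul]
  rw [← memoryAverage_const ha.zero (L * ρ) j]
  exact abs_memoryAverage_sub_le ha fun k hk => (hL k (by omega) _ _).trans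
    (mul_le_mul_of_nonneg_left (hY j x) hL₀)

end estimates

/-! ### Strict differentiability, and truncated Caputo integrals. -/

/-- Mean value inequality on a convex neighbourhood. Both points must be free, because grid maxima
only converge to the contact point, which may lie on the final time slice. -/
theorem exists_strict_of_contDiffOn {E : Type*} [NormedAddCommGroup E] [NormedSpace ℝ E]
    {F : E → ℝ} {s : Set E} (hs : Convex ℝ s) (hu : UniqueDiffOn ℝ s) (hF : ContDiffOn ℝ 1 F s)
    {P : E} (hP : P ∈ s) {ε : ℝ} (hε : 0 < ε) :
    ∃ δ > 0, ∀ p ∈ s ∩ Metric.ball P δ, ∀ q ∈ s ∩ Metric.ball P δ,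
      |F p - F q - fderivWithin ℝ F s P (p - q)| ≤ ε * ‖p - q‖ := by
  have hc := hF.continuousOn_fderivWithin hu le_rfl
  obtain ⟨δ, hδ, h⟩ := Metric.continuousOn_iff.1 hc P hP ε hε
  refine ⟨δ, hδ, fun p hp q hq => ?_⟩
  refine (hs.inter (convex_ball P δ)).norm_image_sub_le_of_norm_hasFDerivWithin_le'
    (f := F) (f' := fderivWithin ℝ F s) (fun x hx => ?_) (fun x hx => ?_) hq hp
  · exact ((hF.differentiableOn one_ne_zero x hx.1).hasFDerivWithinAt).mono inter_subset_left
  · rw [← dist_eq_norm]; exact (h x hx.1 hx.2).le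

section integrals
variable {α t : ℝ} {f : ℝ → ℝ}

theorem continuousOn_caputoIntegrand (hf : ContinuousOn f (Icc 0 t)) :
    ContinuousOn (caputoIntegrand α f t) (Ioc 0 t) := by
  unfold caputoIntegrand
  refine ContinuousOn.div (continuousOn_const.sub (hf.comp (by fun_prop) fun τ hτ => ?_))
    (continuousOn_id.rpow_const fun τ hτ => Or.inl hτ.1.ne')
    fun τ hτ => (Real.rpow_pos_of_pos hτ.1 _).ne'
  exact ⟨by linarith [hτ.2], by linarith [hτ.1]⟩

theorem intervalIntegrable_caputoIntegrand (hf : ContinuousOn f (Icc 0 t)) {r R : ℝ} (hr : 0 < r)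
    (hrR : r ≤ R) (hR : R ≤ t) : IntervalIntegrable (caputoIntegrand α f t) volume r R := by
  refine ((continuousOn_caputoIntegrand hf).mono fun τ hτ => ?_).intervalIntegrable
  rw [uIcc_of_le hrR] at hτ
  exact ⟨hr.trans_le hτ.1, hτ.2.trans hR⟩

theorem abs_caputoIntegrand_le {C τ : ℝ} (hτ : 0 < τ) (h : |f t - f (t - τ)| ≤ C * τ) :
    |caputoIntegrand α f t τ| ≤ C * τ ^ (-α) := by
  have hp : 0 < τ ^ (α + 1) := Real.rpow_pos_of_pos hτ _
  rw [caputoIntegrand, abs_div, abs_of_pos hp, div_le_iff₀ hp, mul_assoc, ← Real.rpow_add hτ]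
  simpa using h

theorem intervalIntegrable_caputoIntegrand_zero (hα₁ : α < 1) (hf : ContinuousOn f (Icc 0 t))
    {C : ℝ} (h : ∀ τ ∈ Icc 0 t, |f t - f (t - τ)| ≤ C * τ) {r : ℝ} (hr : 0 ≤ r) (hrt : r ≤ t) :
    IntervalIntegrable (caputoIntegrand α f t) volume 0 r := by
  have h1 : IntervalIntegrable (fun τ : ℝ => C * τ ^ (-α)) volume 0 r :=
    (intervalIntegral.intervalIntegrable_rpow' (by linarith)).const_mul C
  refine h1.mono_fun ?_ ?_
  · rw [uIoc_of_le hr]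
    exact ((continuousOn_caputoIntegrand hf).mono (Ioc_subset_Ioc_right hrt)).aestronglyMeasurable
      measurableSet_Ioc
  · rw [uIoc_of_le hr]
    refine (ae_restrict_iff' measurableSet_Ioc).2 (Eventually.of_forall fun τ hτ => ?_)
    exact (abs_caputoIntegrand_le hτ.1 (h τ ⟨hτ.1.le, hτ.2.trans hrt⟩)).trans (le_abs_self _)

theorem abs_J_le (hα₀ : 0 < α) (hα₁ : α < 1)
    {C : ℝ} (h : ∀ τ ∈ Icc 0 t, |f t - f (t - τ)| ≤ C * τ) {r : ℝ} (hr : 0 ≤ r) (hrt : r ≤ t) :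
    |J α r f t| ≤ α / Real.Gamma (1 - α) * (C * (r ^ (1 - α) / (1 - α))) := by
  have hΓ : 0 < Real.Gamma (1 - α) := Real.Gamma_pos_of_pos (by linarith)
  rw [J, abs_mul, abs_of_pos (div_pos hα₀ hΓ)]
  refine mul_le_mul_of_nonneg_left ?_ (div_pos hα₀ hΓ).le
  have h1 : IntervalIntegrable (fun τ : ℝ => C * τ ^ (-α)) volume 0 r :=
    (intervalIntegral.intervalIntegrable_rpow' (by linarith)).const_mul C
  have h2 := intervalIntegral.norm_integral_le_of_norm_le hr
    (f := caputoIntegrand α f t) (g := fun τ : ℝ => C * τ ^ (-α)) (μ := volume)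
    (Eventually.of_forall fun τ hτ =>
      abs_caputoIntegrand_le hτ.1 (h τ ⟨hτ.1.le, hτ.2.trans hrt⟩)) h1
  refine h2.trans_eq ?_
  rw [intervalIntegral.integral_const_mul, integral_rpow (Or.inl (by linarith)),
    Real.zero_rpow (by linarith), sub_zero, neg_add_eq_sub]

theorem tendsto_J_zero (hα₀ : 0 < α) (hα₁ : α < 1) (ht : 0 < t)
    {C : ℝ} (h : ∀ τ ∈ Icc 0 t, |f t - f (t - τ)| ≤ C * τ) :
    Tendsto (fun r => J α r f t) (𝓝[>] 0) (𝓝 0) := by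
  refine squeeze_zero_norm'
    (a := fun r => α / Real.Gamma (1 - α) * (C * (r ^ (1 - α) / (1 - α)))) ?_ ?_
  · filter_upwards [Ioc_mem_nhdsGT ht] with r hr
    exact abs_J_le hα₀ hα₁ h hr.1.le hr.2
  · have : ContinuousAt (fun r : ℝ => α / Real.Gamma (1 - α) * (C * (r ^ (1 - α) / (1 - α)))) 0 :=
      continuousAt_const.mul (continuousAt_const.mul
        ((Real.continuousAt_rpow_const _ _ (Or.inr (by linarith))).div_const _))
    have h0 := this.tendsto
    rw [Real.zero_rpow (by linarith)] at h0
    simp only [zero_div, mul_zero] at h0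
    exact h0.mono_left nhdsWithin_le_nhds

theorem K_eq_add (hf : ContinuousOn f (Icc 0 t)) {r R : ℝ} (hr : 0 < r)
    (hrR : r ≤ R) (hR : R ≤ t) : K α r f t =
      K α R f t + α / Real.Gamma (1 - α) * ∫ τ in r..R, caputoIntegrand α f t τ := by
  rw [K, K, ← intervalIntegral.integral_add_adjacent_intervals
    (intervalIntegrable_caputoIntegrand hf hr hrR hR)
    (intervalIntegrable_caputoIntegrand hf (hr.trans_le hrR) hR le_rfl)]
  ring

/-- If `f - φ` has a maximum at `t` over `[t - R, t]` and `K_r[f](t)` is asymptotically at most `c`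
as `r → 0`, then `J_R[φ](t) + K_R[f](t) ≤ c`. -/
theorem J_add_K_le (hα₀ : 0 < α) (hα₁ : α < 1) (hf : ContinuousOn f (Icc 0 t)) {φ : ℝ → ℝ}
    (hφ : ContinuousOn φ (Icc 0 t)) {C : ℝ} (hC : ∀ τ ∈ Icc 0 t, |φ t - φ (t - τ)| ≤ C * τ)
    {R c : ℝ} (hR : 0 < R) (hRt : R ≤ t) (hmax : ∀ τ ∈ Icc 0 R, φ t - φ (t - τ) ≤ f t - f (t - τ))
    (hK : ∀ η > 0, ∀ᶠ r in 𝓝[>] 0, K α r f t ≤ c + η) :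
    J α R φ t + K α R f t ≤ c := by
  have hΓ : 0 < Real.Gamma (1 - α) := Real.Gamma_pos_of_pos (by linarith)
  refine le_of_forall_pos_le_add fun η hη => ?_
  have hJ := (tendsto_J_zero hα₀ hα₁ (hR.trans_le hRt) hC).eventually (gt_mem_nhds (half_pos hη))
  obtain ⟨r, ⟨h1, h2⟩, h3⟩ := ((hK (η / 2) (half_pos hη)).and hJ |>.and
    (Ioc_mem_nhdsGT hR)).exists
  have e1 : J α R φ t = J α r φ t +
      α / Real.Gamma (1 - α) * ∫ τ in r..R, caputoIntegrand α φ t τ := by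
    rw [J, J, ← mul_add, intervalIntegral.integral_add_adjacent_intervals
      (intervalIntegrable_caputoIntegrand_zero hα₁ hφ hC h3.1.le (h3.2.trans hRt))
      (intervalIntegrable_caputoIntegrand hφ h3.1 h3.2 hRt)]
  have e2 := K_eq_add (α := α) hf h3.1 h3.2 hRt
  -- Passing from R to r transfers the piece over [r, R] from φ to f; the maximum makes this change
  -- favourable, and J_r[φ] is negligible.
  have e3 : ∫ τ in r..R, caputoIntegrand α φ t τ ≤ ∫ τ in r..R, caputoIntegrand α f t τ := by
    refine intervalIntegral.integral_mono_on h3.2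
      (intervalIntegrable_caputoIntegrand hφ h3.1 h3.2 hRt)
      (intervalIntegrable_caputoIntegrand hf h3.1 h3.2 hRt) fun τ hτ => ?_
    have hτ0 : 0 < τ := h3.1.trans_le hτ.1
    exact div_le_div_of_nonneg_right (hmax τ ⟨hτ0.le, hτ.2⟩) (Real.rpow_pos_of_pos hτ0 _).le
  have e4 := mul_le_mul_of_nonneg_left e3 (div_pos hα₀ hΓ).le
  linarith

end integrals

/-! ### Test functions up to the final time. -/

section testFunction
variable {d : ℕ} {T : ℝ} {φ : ℝ → Space d → ℝ} (hφ : IsTestFunction T φ)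

theorem convex_halfOpenCylinder (d : ℕ) (T : ℝ) : Convex ℝ (halfOpenCylinder d T) :=
  (convex_Ioc 0 T).prod convex_univ

theorem uniqueDiffOn_halfOpenCylinder (d : ℕ) (T : ℝ) : UniqueDiffOn ℝ (halfOpenCylinder d T) :=
  (uniqueDiffOn_Ioc 0 T).prod uniqueDiffOn_univ

/-- Slices of constant time are full copies of ℝ^d, even at t = T, so in space directions the
derivative within the cylinder is an ordinary one. -/
theorem fderivWithin_halfOpenCylinder_apply {F : ℝ × Space d → ℝ} {t : ℝ} {x : Space d}
    (ht : t ∈ Ioc 0 T) (hF : DifferentiableWithinAt ℝ F (halfOpenCylinder d T) (t, x))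
    (v : Space d) :
    fderivWithin ℝ F (halfOpenCylinder d T) (t, x) (0, v)
      = inner ℝ (gradient (fun y => F (t, y)) x) v := by
  have h1 : HasFDerivAt (fun y : Space d => (t, y)) (ContinuousLinearMap.inr ℝ ℝ (Space d)) x :=
    hasFDerivAt_prodMk_right t x
  have h2 : HasFDerivAt (fun y => F (t, y))
      ((fderivWithin ℝ F (halfOpenCylinder d T) (t, x)).comp
        (ContinuousLinearMap.inr ℝ ℝ (Space d))) x :=
    hF.hasFDerivWithinAt.comp_hasFDerivAt x h1
      (Eventually.of_forall fun y => ⟨ht, mem_univ y⟩)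
  rw [gradient, InnerProductSpace.toDual_symm_apply, h2.fderiv]
  simp

include hφ

theorem IsTestFunction.continuousOn_time (x : Space d) :
    ContinuousOn (fun t => φ t x) (Icc 0 T) :=
  hφ.continuousOn.comp (f := fun t => (t, x)) (by fun_prop) fun _ ht => ⟨ht, mem_univ x⟩

/-- Differentiability at t handles small τ; for τ ≥ ρ boundedness suffices, as 2M ≤ (2M/ρ) τ. It
makes the singular integrand O(τ^(-α)). -/
theorem IsTestFunction.exists_abs_sub_le {t : ℝ} (ht : t ∈ Ioc 0 T) (x : Space d) :
    ∃ C, ∀ τ ∈ Icc 0 t, |φ t x - φ (t - τ) x| ≤ C * τ := by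
  have hm : ∀ s ∈ Ioc 0 T, (s, x) ∈ halfOpenCylinder d T := fun s hs => ⟨hs, mem_univ x⟩
  obtain ⟨δ, hδ, h⟩ := exists_strict_of_contDiffOn (convex_halfOpenCylinder d T)
    (uniqueDiffOn_halfOpenCylinder d T) hφ.contDiffOn (hm t ht) one_pos
  set L := fderivWithin ℝ (Function.uncurry φ) (halfOpenCylinder d T) (t, x)
  obtain ⟨M, hM⟩ := isCompact_Icc.exists_bound_of_continuousOn (hφ.continuousOn_time x)
  have hM0 : 0 ≤ M := (norm_nonneg _).trans (hM t ⟨ht.1.le, ht.2⟩)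
  set ρ := min δ t
  have hρ : 0 < ρ := lt_min hδ ht.1
  refine ⟨max (‖L‖ + 1) (2 * M / ρ), fun τ hτ => ?_⟩
  rcases lt_or_ge τ ρ with hlt | hge
  · have h1 := h (t, x) ⟨hm t ht, Metric.mem_ball_self hδ⟩ (t - τ, x)
      ⟨hm _ ⟨by linarith [hlt.trans_le (min_le_right δ t)], by linarith [hτ.1, ht.2]⟩, by
        rw [Metric.mem_ball, Prod.dist_eq, dist_self, Real.dist_eq]
        rw [max_lt_iff]
        refine ⟨?_, hδ⟩
        rw [show t - τ - t = -τ by ring, abs_neg, abs_of_nonneg hτ.1]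
        exact hlt.trans_le (min_le_left δ t)⟩
    have e : ‖((t, x) : ℝ × Space d) - (t - τ, x)‖ = τ := by
      rw [Prod.mk_sub_mk, sub_self, sub_sub_cancel, Prod.norm_mk, norm_zero, Real.norm_eq_abs,
        abs_of_nonneg hτ.1, max_eq_left hτ.1]
    have h2 := L.le_opNorm (((t, x) : ℝ × Space d) - (t - τ, x))
    rw [e] at h1 h2
    simp only [Function.uncurry_apply_pair] at h1
    have h3 := abs_sub_abs_le_abs_sub (φ t x - φ (t - τ) x)
      (L (((t, x) : ℝ × Space d) - (t - τ, x)))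
    rw [Real.norm_eq_abs] at h2
    have : |φ t x - φ (t - τ) x| ≤ (‖L‖ + 1) * τ := by linarith
    exact this.trans (mul_le_mul_of_nonneg_right (le_max_left _ _) hτ.1)
  · have h1 := hM t ⟨ht.1.le, ht.2⟩
    have h2 := hM (t - τ) ⟨by linarith [hτ.2], by linarith [hτ.1, ht.2]⟩
    have h3 : |φ t x - φ (t - τ) x| ≤ 2 * M := by
      refine (abs_sub _ _).trans ?_
      rw [Real.norm_eq_abs] at h1 h2; linarith
    refine h3.trans ((?_ : 2 * M ≤ 2 * M / ρ * τ).trans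
      (mul_le_mul_of_nonneg_right (le_max_right _ _) hτ.1))
    rw [div_mul_eq_mul_div, le_div_iff₀ hρ]
    exact mul_le_mul_of_nonneg_left hge (by linarith)

end testFunction

/-! ### Ultrafilter limits, and the weights as a quadrature of the Caputo integral. -/

theorem exists_tendsto_of_eventually_mem_compact {ι X : Type*} [TopologicalSpace X]
    {𝒰 : Ultrafilter ι} {s : Set X} (hs : IsCompact s) {f : ι → X} (h : ∀ᶠ i in 𝒰, f i ∈ s) :
    ∃ x ∈ s, Tendsto f 𝒰 (𝓝 x) := by
  obtain ⟨x, hx, hle⟩ := hs.ultrafilter_le_nhds (𝒰.map f) (le_principal_iff.2 h)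
  exact ⟨x, hx, hle⟩

theorem tendsto_intervalIntegral_endpoints {ι : Type*} {l : Filter ι} {w : ℝ → ℝ} {r t : ℝ}
    (hrt : r ≤ t) (hw : ContinuousOn w (Icc r t)) {p q : ι → ℝ} (hp : ∀ᶠ i in l, p i ∈ Icc r t)
    (hq : ∀ᶠ i in l, q i ∈ Icc r t) (hpr : Tendsto p l (𝓝 r)) (hqt : Tendsto q l (𝓝 t)) :
    Tendsto (fun i => ∫ τ in p i..q i, w τ) l (𝓝 (∫ τ in r..t, w τ)) := by
  have hint : IntegrableOn w (uIcc r t) := by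
    rw [uIcc_of_le hrt]; exact hw.integrableOn_Icc
  have hc := intervalIntegral.continuousOn_primitive_interval hint
  rw [uIcc_of_le hrt] at hc hint
  have h1 : Tendsto (fun i => ∫ τ in r..q i, w τ) l (𝓝 (∫ τ in r..t, w τ)) :=
    (hc t ⟨hrt, le_rfl⟩).tendsto.comp (tendsto_nhdsWithin_iff.2 ⟨hqt, hq⟩)
  have h2 : Tendsto (fun i => ∫ τ in r..p i, w τ) l (𝓝 (∫ τ in r..r, w τ)) :=
    (hc r ⟨le_rfl, hrt⟩).tendsto.comp (tendsto_nhdsWithin_iff.2 ⟨hpr, hp⟩)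
  have h3 := h1.sub h2
  rw [intervalIntegral.integral_same, sub_zero] at h3
  have hii : ∀ s ∈ Icc r t, IntervalIntegrable w volume r s := fun s hs =>
    (hint.mono_set (by rw [uIcc_of_le hs.1]; exact Icc_subset_Icc_right hs.2)).intervalIntegrable
  refine h3.congr' ?_
  filter_upwards [hp, hq] with i hpi hqi
  exact intervalIntegral.integral_interval_sub_left (hii _ hqi) (hii _ hpi)

section kernel
variable {α : ℝ} (hα : 0 < α)
include hα

/-- The value (k+1)h back in time is weighted by the kernel mass of the cell [(k+1)h, (k+2)h]: a
step-function quadrature omitting [0, h]. -/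
theorem caputoKernel_sub_succ {h : ℝ} (hh : 0 < h) (k : ℕ) :
    caputoKernel α k - caputoKernel α (k + 1) =
      h ^ α * (α * ∫ τ in ((k : ℝ) + 1) * h..((k : ℝ) + 2) * h, 1 / τ ^ (α + 1)) := by
  have h1 : 0 < ((k : ℝ) + 1) * h := by positivity
  have h2 : 0 < ((k : ℝ) + 2) * h := by positivity
  have hle : ((k : ℝ) + 1) * h ≤ ((k : ℝ) + 2) * h := by nlinarith
  have e : ∫ τ in ((k : ℝ) + 1) * h..((k : ℝ) + 2) * h, 1 / τ ^ (α + 1) =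
      ∫ τ in ((k : ℝ) + 1) * h..((k : ℝ) + 2) * h, τ ^ (-(α + 1)) := by
    refine intervalIntegral.integral_congr fun τ hτ => ?_
    rw [uIcc_of_le hle] at hτ
    rw [Real.rpow_neg (h1.le.trans hτ.1), one_div]
  rw [e, integral_rpow (Or.inr ⟨by linarith, by
    rw [uIcc_of_le hle]; exact fun h0 => absurd h0.1 (by linarith)⟩),
    show -(α + 1) + 1 = -α by ring, Real.mul_rpow (by positivity) hh.le,
    Real.mul_rpow (by positivity) hh.le, caputoKernel, caputoKernel]
  have h3 : h ^ α * h ^ (-α) = 1 := by rw [← Real.rpow_add hh]; simp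
  push_cast
  rw [show (k : ℝ) + 1 + 1 = k + 2 by ring]
  have hne : α ≠ 0 := hα.ne'
  field_simp
  linear_combination (((k : ℝ) + 2) ^ (-α) - ((k : ℝ) + 1) ^ (-α)) * h3

theorem sum_caputoKernel_le_integral {h : ℝ} (hh : 0 < h) {k₀ n : ℕ} (hkn : k₀ ≤ n) {G : ℕ → ℝ}
    {w : ℝ → ℝ} (hw : ContinuousOn w (Icc (((k₀ : ℝ) + 1) * h) (((n : ℝ) + 1) * h)))
    (hG : ∀ k ∈ Finset.Ico k₀ n, ∀ τ ∈ Icc (((k : ℝ) + 1) * h) (((k : ℝ) + 2) * h),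
      G k / τ ^ (α + 1) ≤ w τ) :
    ∑ k ∈ Finset.Ico k₀ n, (caputoKernel α k - caputoKernel α (k + 1)) * G k ≤
      h ^ α * (α * ∫ τ in ((k₀ : ℝ) + 1) * h..((n : ℝ) + 1) * h, w τ) := by
  have hint : ∀ k ∈ Ico k₀ n, IntervalIntegrable w volume
      ((fun j : ℕ => ((j : ℝ) + 1) * h) k) ((fun j : ℕ => ((j : ℝ) + 1) * h) (k + 1)) := by
    intro k hk
    refine (hw.mono ?_).intervalIntegrable
    have h1 : (k₀ : ℝ) ≤ k := by exact_mod_cast hk.1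
    have h2 : (k : ℝ) + 1 ≤ n := by exact_mod_cast hk.2
    push_cast
    rw [uIcc_of_le (by nlinarith)]
    exact Icc_subset_Icc (by nlinarith) (by nlinarith)
  rw [← intervalIntegral.sum_integral_adjacent_intervals_Ico hkn hint, Finset.mul_sum,
    Finset.mul_sum]
  refine Finset.sum_le_sum fun k hk => ?_
  rw [caputoKernel_sub_succ hα hh, mul_assoc, mul_assoc]
  have hp : 0 < h ^ α := Real.rpow_pos_of_pos hh _
  refine mul_le_mul_of_nonneg_left (mul_le_mul_of_nonneg_left ?_ hα.le) hp.le
  have hint' := hint k (by simpa using hk)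
  have hk1 : 0 < ((k : ℝ) + 1) * h := by positivity
  have hle : ((k : ℝ) + 1) * h ≤ ((k : ℝ) + 2) * h := by nlinarith
  rw [← intervalIntegral.integral_mul_const]
  simp only [Nat.cast_add, Nat.cast_one, show (k : ℝ) + 1 + 1 = k + 2 by ring] at hint' ⊢
  refine intervalIntegral.integral_mono_on hle ?_ hint' fun τ hτ => ?_
  · refine ContinuousOn.intervalIntegrable ?_
    rw [uIcc_of_le hle]
    refine (continuousOn_const.div (continuousOn_id.rpow_const fun τ hτ => ?_)
      fun τ hτ => ?_).mul continuousOn_const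
    · exact Or.inl (hk1.trans_le hτ.1).ne'
    · exact (Real.rpow_pos_of_pos (hk1.trans_le hτ.1) _).ne'
  · rw [one_div_mul_eq_div]
    exact hG k hk τ hτ

/-- On each cell (k+1)h ≤ τ, so the sum is controlled by the integral of τ^(-α), which converges at
0. -/
theorem sum_caputoKernel_mul_succ_le (hα₁ : α < 1) {h : ℝ} (hh : 0 < h) (n : ℕ) :
    ∑ k ∈ Finset.range n, (caputoKernel α k - caputoKernel α (k + 1)) * (((k : ℝ) + 1) * h) ≤
      h ^ α * (α * ((((n : ℝ) + 1) * h) ^ (1 - α) / (1 - α))) := by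
  have hp : 0 < h ^ α := Real.rpow_pos_of_pos hh _
  rw [← Nat.Ico_zero_eq_range]
  have h0 : 0 < (((0 : ℕ) : ℝ) + 1) * h := by positivity
  refine (sum_caputoKernel_le_integral hα hh (Nat.zero_le n) (w := fun τ => τ ^ (-α)) ?_ ?_).trans
    ?_
  · exact continuousOn_id.rpow_const fun τ hτ => Or.inl (h0.trans_le hτ.1).ne'
  · intro k _ τ hτ
    have hk : 0 < ((k : ℝ) + 1) * h := by positivity
    have hτ0 := hk.trans_le hτ.1
    rw [div_le_iff₀ (Real.rpow_pos_of_pos hτ0 _), ← Real.rpow_add hτ0]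
    simpa using hτ.1
  · refine mul_le_mul_of_nonneg_left (mul_le_mul_of_nonneg_left ?_ hα.le) hp.le
    rw [integral_rpow (Or.inl (by linarith)), neg_add_eq_sub]
    refine div_le_div_of_nonneg_right ?_ (by linarith)
    have := Real.rpow_pos_of_pos h0 (1 - α)
    linarith

end kernel

/-! ### Grid maxima and convergence of the scheme. -/

theorem exists_grid_isMaxOn {X : Type*} [TopologicalSpace X] {s : Set X} (hs : IsCompact s)
    {G : Finset ℕ} (hne : ((G : Set ℕ) ×ˢ s).Nonempty) {f : ℕ → X → ℝ}
    (hf : ∀ n ∈ G, ContinuousOn (f n) s) :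
    ∃ n ∈ G, ∃ x ∈ s, ∀ k ∈ G, ∀ y ∈ s, f k y ≤ f n x := by
  obtain ⟨⟨n₀, x₀⟩, hn₀, hx₀⟩ := hne
  have h : ∀ n ∈ G, ∃ x ∈ s, ∀ y ∈ s, f n y ≤ f n x := fun n hn =>
    hs.exists_isMaxOn ⟨x₀, hx₀⟩ (hf n hn)
  have : Nonempty X := ⟨x₀⟩
  choose! z hz hmax using h
  obtain ⟨n, hn, hmn⟩ := G.exists_max_image (fun n => f n (z n)) ⟨n₀, hn₀⟩
  exact ⟨n, hn, z n, hz n hn, fun k hk y hy => (hmax k hk y hy).trans (hmn k hk)⟩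

/-- The time step of the scheme with `m + 1` steps. -/
noncomputable def timeStep (T : ℝ) (m : ℕ) : ℝ := T / ((m : ℝ) + 1)

theorem timeStep_pos {T : ℝ} (hT : 0 < T) (m : ℕ) : 0 < timeStep T m := by
  unfold timeStep; positivity

theorem mul_timeStep_le_iff {T : ℝ} (hT : 0 < T) (m n : ℕ) :
    n * timeStep T m ≤ T ↔ n ≤ m + 1 := by
  rw [timeStep, ← mul_div_assoc, div_le_iff₀ (by positivity), mul_comm,
    mul_le_mul_iff_right₀ hT]
  exact_mod_cast Iff.rfl

theorem tendsto_timeStep (T : ℝ) : Tendsto (timeStep T) atTop (𝓝 0) :=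
  tendsto_const_nhds.div_atTop (tendsto_natCast_atTop_atTop.atTop_add tendsto_const_nhds)

theorem tendsto_floor_mul {ι : Type*} {l : Filter ι} {h : ι → ℝ} (hpos : ∀ i, 0 < h i)
    (hh : Tendsto h l (𝓝 0)) {t : ℝ} (ht : 0 ≤ t) :
    Tendsto (fun i => (⌊t / h i⌋₊ : ℝ) * h i) l (𝓝 t) := by
  refine tendsto_of_tendsto_of_tendsto_of_le_of_le (g := fun i => t - h i) (h := fun _ => t)
    ?_ tendsto_const_nhds (fun i => ?_) (fun i => ?_)
  · simpa using tendsto_const_nhds.sub hh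
  · have := (Nat.lt_floor_add_one (t / h i))
    rw [div_lt_iff₀ (hpos i)] at this
    simp only; linarith
  · have := Nat.floor_le (div_nonneg ht (hpos i).le)
    rwa [le_div_iff₀ (hpos i)] at this

/-- The foot of the discrete characteristic ending at `(n h, x)`. -/
noncomputable def foot {d : ℕ} (α : ℝ) (b : ℝ → Space d → Space d) (h : ℝ) (n : ℕ)
    (x : Space d) : Space d :=
  x - (Real.Gamma (1 - α) * h ^ α) • b (n * h) x

/-- `u` is the continuous limit of the solutions `U m` of the schemes with `m + 1` time steps,
along the ultrafilter `𝒰`. -/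
structure IsSchemeLimit {d : ℕ} (α T : ℝ) (b : ℝ → Space d → Space d) (𝒰 : Ultrafilter ℕ)
    (U : ℕ → ℕ → Space d → ℝ) (u : ℝ → Space d → ℝ) : Prop where
  continuous : ∀ m n, Continuous (U m n)
  step : ∀ m n, n + 1 ≤ m + 1 → ∀ x, U m (n + 1) x = memoryAverage (caputoKernel α)
    (fun k => U m k (foot α b (timeStep T m) (n + 1) x)) n
  tendsto : ∀ (n : ℕ → ℕ) (x : ℕ → Space d) (t : ℝ) (x₀ : Space d),
    (∀ᶠ m in 𝒰, n m ≤ m + 1) → Tendsto (fun m => n m * timeStep T m) 𝒰 (𝓝 t) →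
    Tendsto x 𝒰 (𝓝 x₀) → Tendsto (fun m => U m (n m) (x m)) 𝒰 (𝓝 (u t x₀))
  continuousOn : ContinuousOn (Function.uncurry u) (closedCylinder d T)

section
variable {d : ℕ} {α T : ℝ} {b : ℝ → Space d → Space d} {𝒰 : Ultrafilter ℕ}
  {U : ℕ → ℕ → Space d → ℝ} {u : ℝ → Space d → ℝ}

/-- A strict maximum of `u - F` is approximated by grid maxima of `U m - F`. -/
theorem IsSchemeLimit.exists_grid_max (hT : 0 < T) (h𝒰 : (𝒰 : Filter ℕ) ≤ atTop)
    (hu : IsSchemeLimit α T b 𝒰 U u) {F : ℝ × Space d → ℝ}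
    (hF : ContinuousOn F (closedCylinder d T)) {a t ρ : ℝ} (ha : 0 ≤ a) (hat : a < t) (htT : t ≤ T)
    (hρ : 0 < ρ) {x : Space d}
    (hmax : ∀ s ∈ Icc a t, ∀ y ∈ Metric.closedBall x ρ,
      u t x - F (t, x) ≤ u s y - F (s, y) → s = t ∧ y = x) :
    ∃ (N : ℕ → ℕ) (z : ℕ → Space d), Tendsto (fun m => N m * timeStep T m) 𝒰 (𝓝 t) ∧
      Tendsto z 𝒰 (𝓝 x) ∧ ∀ᶠ m in 𝒰, N m ≤ m + 1 ∧ N m * timeStep T m ≤ t ∧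
        ∀ (k : ℕ) (y : Space d), a ≤ k * timeStep T m → k * timeStep T m ≤ t →
          y ∈ Metric.closedBall x ρ →
          U m k y - F (k * timeStep T m, y) ≤ U m (N m) (z m) - F (N m * timeStep T m, z m) := by
  have ht0 : 0 ≤ t := ha.trans hat.le
  have hstep : Tendsto (timeStep T) 𝒰 (𝓝 0) := (tendsto_timeStep T).mono_left h𝒰
  set κ : ℕ → ℕ := fun m => ⌊t / timeStep T m⌋₊
  have hκ : Tendsto (fun m => (κ m : ℝ) * timeStep T m) 𝒰 (𝓝 t) :=
    tendsto_floor_mul (timeStep_pos hT) hstep ht0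
  have hκt : ∀ m, (κ m : ℝ) * timeStep T m ≤ t := fun m => by
    have := Nat.floor_le (div_nonneg ht0 (timeStep_pos hT m).le)
    rwa [le_div_iff₀ (timeStep_pos hT m)] at this
  have hκa : ∀ᶠ m in 𝒰, a ≤ κ m * timeStep T m := (hκ.eventually (lt_mem_nhds hat)).mono
    fun _ h => h.le
  have hex : ∀ᶠ m in 𝒰, ∃ p : ℕ × Space d, (a ≤ p.1 * timeStep T m ∧ p.1 * timeStep T m ≤ t) ∧
      p.2 ∈ Metric.closedBall x ρ ∧
        ∀ (k : ℕ) (y : Space d), a ≤ k * timeStep T m → k * timeStep T m ≤ t →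
          y ∈ Metric.closedBall x ρ →
          U m k y - F (k * timeStep T m, y) ≤ U m p.1 p.2 - F (p.1 * timeStep T m, p.2) := by
    filter_upwards [hκa] with m hm
    let G : Finset ℕ := (Finset.range (m + 2)).filter
      fun k => a ≤ k * timeStep T m ∧ k * timeStep T m ≤ t
    have hG : ∀ k : ℕ, k ∈ G ↔ a ≤ k * timeStep T m ∧ k * timeStep T m ≤ t := fun k => by
      simp only [G, Finset.mem_filter, Finset.mem_range, and_iff_right_iff_imp]
      intro hk
      have := (mul_timeStep_le_iff hT m k).1 (hk.2.trans htT)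
      omega
    obtain ⟨n, hn, z, hz, hmx⟩ := exists_grid_isMaxOn (isCompact_closedBall x ρ) (G := G)
      (f := fun k y => U m k y - F (k * timeStep T m, y))
      ⟨(κ m, x), (hG _).2 ⟨hm, hκt m⟩, Metric.mem_closedBall_self hρ.le⟩ (fun n hn => by
        refine (hu.continuous m n).continuousOn.sub (hF.comp (by fun_prop) fun y _ => ?_)
        have := (hG n).1 hn
        exact ⟨⟨ha.trans this.1, this.2.trans htT⟩, mem_univ y⟩)
    exact ⟨(n, z), (hG n).1 hn, hz, fun k y h1 h2 hy => hmx k ((hG k).2 ⟨h1, h2⟩) y hy⟩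
  obtain ⟨p, hp⟩ := Filter.skolem.1 hex
  have hbd : ∀ᶠ m in 𝒰, ((p m).1 : ℝ) * timeStep T m ∈ Icc a t := hp.mono fun m h => h.1
  have hN : ∀ᶠ m in 𝒰, (p m).1 ≤ m + 1 := hp.mono fun m h =>
    (mul_timeStep_le_iff hT m _).1 (h.1.2.trans htT)
  obtain ⟨s, hs, hslim⟩ := exists_tendsto_of_eventually_mem_compact isCompact_Icc hbd
  obtain ⟨y, hy, hylim⟩ := exists_tendsto_of_eventually_mem_compact
    (isCompact_closedBall x ρ) (hp.mono fun m h => h.2.1)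
  have hFlim : ∀ (f : ℕ → ℝ) (g : ℕ → Space d) (s : ℝ) (y : Space d), s ∈ Icc a t →
      (∀ᶠ m in 𝒰, f m ∈ Icc a t) → Tendsto f 𝒰 (𝓝 s) → Tendsto g 𝒰 (𝓝 y) →
      Tendsto (fun m => F (f m, g m)) 𝒰 (𝓝 (F (s, y))) := by
    intro f g s y hs hf h1 h2
    have hsub : Icc a t ⊆ Icc 0 T := Icc_subset_Icc ha htT
    exact (hF (s, y) ⟨hsub hs, mem_univ y⟩).tendsto.comp (tendsto_nhdsWithin_iff.2
      ⟨h1.prodMk_nhds h2, hf.mono fun m hm => ⟨hsub hm, mem_univ _⟩⟩)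
  have l1 := (hu.tendsto _ _ s y hN hslim hylim).sub (hFlim _ _ s y hs hbd hslim hylim)
  have l2 := (hu.tendsto κ (fun _ => x) t x (Eventually.of_forall fun m =>
    (mul_timeStep_le_iff hT m _).1 ((hκt m).trans htT)) hκ tendsto_const_nhds).sub
    (hFlim _ _ t x ⟨hat.le, le_rfl⟩ (hκa.mono fun m h => ⟨h, hκt m⟩) hκ tendsto_const_nhds)
  -- Comparison with the grid point (⌊t/h⌋, x) shows that the limit of the grid maximizers is again
  -- a maximizer; strictness identifies it.
  have hle := le_of_tendsto_of_tendsto l2 l1 ((hp.and hκa).mono fun m h =>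
    h.1.2.2 (κ m) x h.2 (hκt m) (Metric.mem_closedBall_self hρ.le))
  obtain ⟨rfl, rfl⟩ := hmax s hs y hy hle
  exact ⟨fun m => (p m).1, fun m => (p m).2, hslim, hylim,
    (hp.and hN).mono fun m h => ⟨h.2, h.1.1.2, h.1.2.2⟩⟩

theorem IsSchemeLimit.continuousOn_time (hu : IsSchemeLimit α T b 𝒰 U u) (x : Space d) :
    ContinuousOn (fun t => u t x) (Icc 0 T) :=
  hu.continuousOn.comp (f := fun t => (t, x)) (by fun_prop) fun _ ht => ⟨ht, mem_univ x⟩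

/-- Past values of the scheme converge uniformly. -/
theorem IsSchemeLimit.eventually_past_le (hT : 0 < T) (h𝒰 : (𝒰 : Filter ℕ) ≤ atTop)
    (hu : IsSchemeLimit α T b 𝒰 U u) {t : ℝ} (htT : t ≤ T) {x : Space d} {n : ℕ → ℕ}
    {y z : ℕ → Space d} (hn : Tendsto (fun m => (n m + 1 : ℕ) * timeStep T m) 𝒰 (𝓝 t))
    (hnt : ∀ᶠ m in 𝒰, (n m + 1 : ℕ) * timeStep T m ≤ t) (hy : Tendsto y 𝒰 (𝓝 x))
    (hz : Tendsto z 𝒰 (𝓝 x)) {ε : ℝ} (hε : 0 < ε) :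
    ∀ᶠ m in 𝒰, ∀ k < n m, ∀ τ ∈ Icc (((k : ℝ) + 1) * timeStep T m) (((k : ℝ) + 2) * timeStep T m),
      U m (n m - k) (y m) - U m (n m + 1) (z m) ≤ u (t - τ) x - u t x + ε := by
  have hstep : Tendsto (timeStep T) 𝒰 (𝓝 0) := (tendsto_timeStep T).mono_left h𝒰
  -- For an ultrafilter, failure of an eventual statement is itself eventual, so violating k and τ
  -- can be chosen and sent to a limit by compactness.
  by_contra hcon
  rw [← Ultrafilter.eventually_not] at hcon
  have hex : ∀ᶠ m in 𝒰, ∃ p : ℕ × ℝ, p.1 < n m ∧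
      p.2 ∈ Icc (((p.1 : ℝ) + 1) * timeStep T m) (((p.1 : ℝ) + 2) * timeStep T m) ∧
      u (t - p.2) x - u t x + ε < U m (n m - p.1) (y m) - U m (n m + 1) (z m) := by
    filter_upwards [hcon] with m hm
    push Not at hm
    obtain ⟨k, hk, τ, hτ, h⟩ := hm
    exact ⟨(k, τ), hk, hτ, h⟩
  obtain ⟨p, hp⟩ := Filter.skolem.1 hex
  have hτmem : ∀ᶠ m in 𝒰, (p m).2 ∈ Icc 0 t := by
    filter_upwards [hp, hnt] with m hm hmt
    have hs := timeStep_pos hT m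
    have h1 : ((p m).1 : ℝ) + 1 ≤ n m := by exact_mod_cast hm.1
    push_cast at hmt
    exact ⟨le_trans (by positivity) hm.2.1.1, hm.2.1.2.trans (by nlinarith)⟩
  obtain ⟨τ, hτ, hτlim⟩ := exists_tendsto_of_eventually_mem_compact isCompact_Icc hτmem
  have hnle : ∀ᶠ m in 𝒰, n m + 1 ≤ m + 1 := hnt.mono fun m hm =>
    (mul_timeStep_le_iff hT m _).1 (hm.trans htT)
  have hklim : Tendsto (fun m => ((p m).1 + 1 : ℝ) * timeStep T m) 𝒰 (𝓝 τ) := by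
    have h1 : Tendsto (fun m => (p m).2 - timeStep T m) 𝒰 (𝓝 τ) := by simpa using hτlim.sub hstep
    refine tendsto_of_tendsto_of_tendsto_of_le_of_le' h1 hτlim ?_ (hp.mono fun m hm => hm.2.1.1)
    filter_upwards [hp] with m hm
    have := hm.2.1.2
    linarith
  have hlim1 : Tendsto (fun m => ((n m - (p m).1 : ℕ) : ℝ) * timeStep T m) 𝒰 (𝓝 (t - τ)) := by
    refine (hn.sub hklim).congr' ?_
    filter_upwards [hp] with m hm
    rw [Nat.cast_sub hm.1.le]; push_cast; ring
  have l1 := hu.tendsto _ y (t - τ) x (hnle.mono fun m hm => (Nat.sub_le _ _).trans (by omega))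
    hlim1 hy
  have l2 := hu.tendsto _ z t x hnle hn hz
  have ht0 : 0 ≤ t := hτ.1.trans hτ.2
  have l3 : Tendsto (fun m => u (t - (p m).2) x) 𝒰 (𝓝 (u (t - τ) x)) := by
    refine ((hu.continuousOn_time x) (t - τ) ⟨by linarith [hτ.2], by linarith [hτ.1]⟩).tendsto.comp
      (tendsto_nhdsWithin_iff.2 ⟨tendsto_const_nhds.sub hτlim, ?_⟩)
    filter_upwards [hτmem] with m hm
    exact ⟨by linarith [hm.2], by linarith [hm.1]⟩
  have := le_of_tendsto_of_tendsto ((l3.sub_const (u t x)).add_const ε) (l1.sub l2)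
    (hp.mono fun m hm => hm.2.2.le)
  linarith

end

/-! ### Consistency: the limit is a subsolution. -/

/-- One step of the scheme, divided by the power `h ^ α` of the time step: the recent past is
estimated by `C * τ + Γ(1-α) h^α * E`, the older past by the function `w`. -/
theorem scheme_step_inequality {α : ℝ} (hα : 0 < α) (hα₁ : α < 1) {h γ C E W : ℝ} (hh : 0 < h)
    {n k₀ : ℕ} (hk : k₀ ≤ n) {V : ℕ → ℝ} (hW : W = memoryAverage (caputoKernel α) V n)
    (hC : 0 ≤ C)
    (hrecent : ∀ k < k₀, V (n - k) - W ≤ C * (((k : ℝ) + 1) * h) + γ * h ^ α * E) {w : ℝ → ℝ}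
    (hw : ContinuousOn w (Icc (((k₀ : ℝ) + 1) * h) (((n : ℝ) + 1) * h)))
    (hold : ∀ k ∈ Finset.Ico k₀ n, ∀ τ ∈ Icc (((k : ℝ) + 1) * h) (((k : ℝ) + 2) * h),
      (V (n - k) - W) / τ ^ (α + 1) ≤ w τ) :
    0 ≤ C * (α * ((((k₀ : ℝ) + 1) * h) ^ (1 - α) / (1 - α))) +
      γ * E * (1 - caputoKernel α k₀) +
      α * (∫ τ in ((k₀ : ℝ) + 1) * h..((n : ℝ) + 1) * h, w τ) +
      (((n : ℝ) + 1) * h) ^ (-α) * (V 0 - W) := by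
  have hp : 0 < h ^ α := Real.rpow_pos_of_pos hh _
  have hker := isMemoryKernel_caputoKernel hα
  set a := caputoKernel α
  have h0 : memoryAverage a (fun k => V k - W) n = 0 := by
    rw [memoryAverage_sub, ← hW, memoryAverage_const hker.zero, sub_self]
  rw [memoryAverage, ← Finset.sum_range_add_sum_Ico _ hk] at h0
  have h1 : ∑ k ∈ Finset.range k₀, (a k - a (k + 1)) * (V (n - k) - W) ≤
      C * (h ^ α * (α * ((((k₀ : ℝ) + 1) * h) ^ (1 - α) / (1 - α)))) +
        γ * h ^ α * E * (1 - a k₀) := by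
    calc _ ≤ ∑ k ∈ Finset.range k₀, (C * ((a k - a (k + 1)) * (((k : ℝ) + 1) * h)) +
          γ * h ^ α * E * (a k - a (k + 1))) := by
          refine Finset.sum_le_sum fun k hk => ?_
          have := mul_le_mul_of_nonneg_left (hrecent k (Finset.mem_range.1 hk))
            (sub_nonneg.2 (hker.antitone (Nat.le_succ k)))
          refine this.trans_eq (by ring)
      _ = C * (∑ k ∈ Finset.range k₀, (a k - a (k + 1)) * (((k : ℝ) + 1) * h)) +
          γ * h ^ α * E * (1 - a k₀) := by
          rw [Finset.sum_add_distrib, ← Finset.mul_sum, ← Finset.mul_sum,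
            Finset.sum_range_sub', hker.zero]
      _ ≤ _ := by
          gcongr
          exact sum_caputoKernel_mul_succ_le hα hα₁ hh k₀
  have h2 := sum_caputoKernel_le_integral hα hh hk (G := fun k => V (n - k) - W) hw hold
  -- The weight of the initial value carries the same factor h ^ α as the other terms, so h ^ α can
  -- be divided out.
  have h3 : a n = h ^ α * (((n : ℝ) + 1) * h) ^ (-α) := by
    rw [Real.mul_rpow (by positivity) hh.le, mul_left_comm, ← Real.rpow_add hh]
    simp [a, caputoKernel]
  rw [h3] at h0
  refine nonneg_of_mul_nonneg_right (a := h ^ α) ?_ hp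
  linarith

section penalty
variable {d : ℕ} {T t : ℝ} {x : Space d} {φ : ℝ → Space d → ℝ}

/-- A test function with a quadratic penalization added. -/
noncomputable def penalize (φ : ℝ → Space d → ℝ) (t : ℝ) (x : Space d) (p : ℝ × Space d) : ℝ :=
  Function.uncurry φ p + ((p.1 - t) ^ 2 + ‖p.2 - x‖ ^ 2)

theorem contDiff_penalty (t : ℝ) (x : Space d) :
    ContDiff ℝ 1 (fun p : ℝ × Space d => (p.1 - t) ^ 2 + ‖p.2 - x‖ ^ 2) :=
  ((contDiff_fst.sub contDiff_const).pow 2).add ((contDiff_snd.sub contDiff_const).norm_sq ℝ)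

theorem IsTestFunction.contDiffOn_penalize (hφ : IsTestFunction T φ) (t : ℝ) (x : Space d) :
    ContDiffOn ℝ 1 (penalize φ t x) (halfOpenCylinder d T) :=
  hφ.contDiffOn.add (contDiff_penalty t x).contDiffOn

theorem IsTestFunction.continuousOn_penalize (hφ : IsTestFunction T φ) (t : ℝ) (x : Space d) :
    ContinuousOn (penalize φ t x) (closedCylinder d T) :=
  hφ.continuousOn.add (contDiff_penalty t x).continuous.continuousOn

theorem IsTestFunction.fderivWithin_penalize_apply (hφ : IsTestFunction T φ) (ht : t ∈ Ioc 0 T)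
    (v : Space d) :
    fderivWithin ℝ (penalize φ t x) (halfOpenCylinder d T) (t, x) (0, v)
      = inner ℝ (gradient (φ t) x) v := by
  have hP : (t, x) ∈ halfOpenCylinder d T := ⟨ht, mem_univ x⟩
  have hd := hφ.contDiffOn.differentiableOn one_ne_zero _ hP
  -- The penalty is critical at (t, x): the maximum becomes strict while the gradient is unchanged.
  have hQ : HasFDerivAt (fun p : ℝ × Space d => (p.1 - t) ^ 2 + ‖p.2 - x‖ ^ 2)
      (0 : ℝ × Space d →L[ℝ] ℝ) (t, x) := by
    have h1 :=
      ((contDiff_penalty t x).differentiable one_ne_zero (t, x)).hasFDerivAt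
    have hmin : IsLocalMin (fun p : ℝ × Space d => (p.1 - t) ^ 2 + ‖p.2 - x‖ ^ 2) (t, x) :=
      Eventually.of_forall fun p => by
        simp only [sub_self, norm_zero]
        nlinarith [sq_nonneg (p.1 - t), sq_nonneg ‖p.2 - x‖]
    rwa [hmin.fderiv_eq_zero] at h1
  have h2 := (hd.hasFDerivWithinAt.add hQ.hasFDerivWithinAt).fderivWithin
    (uniqueDiffOn_halfOpenCylinder d T _ hP)
  have h3 : penalize φ t x =
      Function.uncurry φ + fun p : ℝ × Space d => (p.1 - t) ^ 2 + ‖p.2 - x‖ ^ 2 := rfl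
  rw [h3, h2, add_zero, fderivWithin_halfOpenCylinder_apply ht hd]
  rfl

/-- First-order expansion of a penalized test function along a discrete characteristic. -/
theorem IsTestFunction.exists_penalize_expansion (hφ : IsTestFunction T φ) (ht : t ∈ Ioc 0 T)
    (x : Space d) {ε : ℝ} (hε : 0 < ε) :
    ∃ C ≥ 0, ∃ δ > 0, ∀ s ∈ Ioc 0 T, ∀ σ ≥ 0, 0 < s - σ → |s - t| < δ → |s - σ - t| < δ →
      ∀ (y v : Space d) (c : ℝ), 0 ≤ c → dist y x < δ → dist (y - c • v) x < δ →
      penalize φ t x (s - σ, y - c • v) - penalize φ t x (s, y) ≤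
        C * σ + c * (- inner ℝ (gradient (φ t) x) v + ε * ‖v‖) := by
  have hP : (t, x) ∈ halfOpenCylinder d T := ⟨ht, mem_univ x⟩
  obtain ⟨δ, hδ, h⟩ := exists_strict_of_contDiffOn (convex_halfOpenCylinder d T)
    (uniqueDiffOn_halfOpenCylinder d T) (hφ.contDiffOn_penalize t x) hP hε
  set D := fderivWithin ℝ (penalize φ t x) (halfOpenCylinder d T) (t, x) with hD
  refine ⟨‖D‖ + ε, by positivity, δ, hδ, fun s hs σ hσ hsσ h1 h2 y v c hc h3 h4 => ?_⟩
  have key := h (s - σ, y - c • v) ⟨⟨⟨hsσ, by linarith [hs.2]⟩, mem_univ _⟩, by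
      rw [Metric.mem_ball, Prod.dist_eq, max_lt_iff, Real.dist_eq]; exact ⟨h2, h4⟩⟩
    (s, y) ⟨⟨hs, mem_univ _⟩, by
      rw [Metric.mem_ball, Prod.dist_eq, max_lt_iff, Real.dist_eq]; exact ⟨h1, h3⟩⟩
  have e : ((s - σ, y - c • v) : ℝ × Space d) - (s, y) = (-σ, 0) + (0, -(c • v)) := by
    ext1 <;> simp
  rw [e, map_add, hD, hφ.fderivWithin_penalize_apply ht, ← hD, inner_neg_right,
    inner_smul_right] at key
  have hn : ‖((-σ, 0) : ℝ × Space d) + (0, -(c • v))‖ ≤ σ + c * ‖v‖ := by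
    refine (norm_add_le _ _).trans (le_of_eq ?_)
    simp [Prod.norm_mk, norm_smul, abs_of_nonneg hσ, abs_of_nonneg hc, hσ,
      mul_nonneg hc (norm_nonneg v)]
  have hDσ : D (-σ, 0) ≤ ‖D‖ * σ := by
    refine (le_abs_self _).trans ((D.le_opNorm _).trans (le_of_eq ?_))
    simp [Prod.norm_mk, abs_of_nonneg hσ, hσ]
  have := (abs_le.1 key).2
  have h5 := mul_le_mul_of_nonneg_left hn hε.le
  linarith

end penalty

section
variable {d : ℕ} {α T : ℝ} {b : ℝ → Space d → Space d} {𝒰 : Ultrafilter ℕ}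
  {U : ℕ → ℕ → Space d → ℝ} {u : ℝ → Space d → ℝ}

theorem IsSchemeLimit.eventually_K_le (hα₀ : 0 < α) (hα₁ : α < 1) (hT : 0 < T)
    (h𝒰 : (𝒰 : Filter ℕ) ≤ atTop)
    (hb : ContinuousOn (Function.uncurry b) (closedCylinder d T))
    (hu : IsSchemeLimit α T b 𝒰 U u) {φ : ℝ → Space d → ℝ} (hφ : IsTestFunction T φ)
    {a t ρ : ℝ} (ha : 0 ≤ a) (hat : a < t) (htT : t ≤ T) (hρ : 0 < ρ) {x : Space d}
    (hmax : ∀ s ∈ Icc a t, ∀ y ∈ Metric.closedBall x ρ, u s y - φ s y ≤ u t x - φ t x)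
    {η : ℝ} (hη : 0 < η) :
    ∀ᶠ r in 𝓝[>] 0, K α r (fun s => u s x) t ≤ -inner ℝ (b t x) (gradient (φ t) x) + η := by
  have ht0 : 0 < t := ha.trans_lt hat
  have ht : t ∈ Ioc 0 T := ⟨ht0, htT⟩
  have hstep : Tendsto (timeStep T) 𝒰 (𝓝 0) := (tendsto_timeStep T).mono_left h𝒰
  set γ := Real.Gamma (1 - α)
  have hγ : 0 < γ := Real.Gamma_pos_of_pos (by linarith)
  set g := gradient (φ t) x
  set B := ‖b t x‖ + 1
  have hB : 0 < B := by positivity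
  -- The error η is shared equally by the expansion error ε * B, the recent-past term of order
  -- r^(1-α), and the error ε' in the old past.
  set ε := η / (3 * B)
  have hε : 0 < ε := by positivity
  obtain ⟨C, hC, δ, hδ, hexp⟩ := hφ.exists_penalize_expansion ht x hε
  obtain ⟨N, z, hN, hz, hNz⟩ := hu.exists_grid_max hT h𝒰 (hφ.continuousOn_penalize t x) ha hat htT hρ
    (fun s hs y hy hle => by
      have h1 := hmax s hs y hy
      simp only [penalize, Function.uncurry_apply_pair, sub_self, norm_zero] at hle
      have h2 : (s - t) ^ 2 = 0 := by nlinarith [sq_nonneg (s - t), sq_nonneg ‖y - x‖]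
      have h3 : ‖y - x‖ ^ 2 = 0 := by nlinarith [sq_nonneg (s - t), sq_nonneg ‖y - x‖]
      exact ⟨by linarith [pow_eq_zero_iff (two_ne_zero) |>.1 h2],
        sub_eq_zero.1 (norm_eq_zero.1 (pow_eq_zero_iff (two_ne_zero) |>.1 h3))⟩)
  have hrsmall : Tendsto (fun r : ℝ => C / γ * (α * (r ^ (1 - α) / (1 - α)))) (𝓝[>] 0) (𝓝 0) := by
    have : ContinuousAt (fun r : ℝ => C / γ * (α * (r ^ (1 - α) / (1 - α)))) 0 :=
      continuousAt_const.mul (continuousAt_const.mul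
        ((Real.continuousAt_rpow_const _ _ (Or.inr (by linarith))).div_const _))
    have h0 := this.tendsto
    rw [Real.zero_rpow (by linarith)] at h0
    simp only [zero_div, mul_zero] at h0
    exact h0.mono_left nhdsWithin_le_nhds
  filter_upwards [hrsmall.eventually (gt_mem_nhds (show 0 < η / 3 by positivity)),
    Ioo_mem_nhdsGT (lt_min hδ (sub_pos.2 hat))] with r hr1 hr2
  have hr0 := hr2.1
  have hrδ : r < δ := hr2.2.trans_le (min_le_left _ _)
  have hra : a < t - r := by linarith [hr2.2.trans_le (min_le_right δ (t - a))]
  have hrt : r < t := by linarith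
  set I := ∫ τ in r..t, 1 / τ ^ (α + 1)
  -- Chosen after r, on which the kernel mass I depends.
  set ε' := η / (3 * (α / γ * |I| + 1))
  have hαγ : 0 < α / γ := div_pos hα₀ hγ
  have hε' : 0 < ε' := by positivity
  set h := timeStep T
  have hh : ∀ m, 0 < h m := timeStep_pos hT
  set n : ℕ → ℕ := fun m => N m - 1
  have hNn : ∀ᶠ m in 𝒰, N m = n m + 1 := by
    filter_upwards [hN.eventually (lt_mem_nhds ht0)] with m hm
    have : N m ≠ 0 := by
      intro h0
      rw [h0] at hm; simp at hm
    simp only [n]; omega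
  have hn : Tendsto (fun m => (n m + 1 : ℕ) * h m) 𝒰 (𝓝 t) :=
    hN.congr' (hNn.mono fun m hm => by rw [hm])
  have hn' : Tendsto (fun m => ((n m : ℝ) + 1) * h m) 𝒰 (𝓝 t) := by simpa using hn
  have hnt : ∀ᶠ m in 𝒰, (n m + 1 : ℕ) * h m ≤ t := (hNn.and hNz).mono fun m hm => by
    rw [← hm.1]; exact hm.2.2.1
  have hnle : ∀ᶠ m in 𝒰, n m + 1 ≤ m + 1 := (hNn.and hNz).mono fun m hm => by
    rw [← hm.1]; exact hm.2.1
  have hnpos : ∀ m, 0 < ((n m + 1 : ℕ) : ℝ) * h m := fun m => by have := hh m; positivity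
  set v : ℕ → Space d := fun m => b ((n m + 1 : ℕ) * h m) (z m)
  have hv : Tendsto v 𝒰 (𝓝 (b t x)) :=
    (hb (t, x) ⟨⟨ht0.le, htT⟩, mem_univ x⟩).tendsto.comp (tendsto_nhdsWithin_iff.2
      ⟨hn.prodMk_nhds hz, hnt.mono fun m hm => ⟨⟨(hnpos m).le, hm.trans htT⟩, mem_univ _⟩⟩)
  have hlam : Tendsto (fun m => γ * h m ^ α) 𝒰 (𝓝 0) := by
    have := (hstep.rpow_const (p := α) (Or.inr hα₀.le)).const_mul γ
    simpa [Real.zero_rpow hα₀.ne'] using this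
  have hlam0 : ∀ m, 0 ≤ γ * h m ^ α := fun m => by have := hh m; positivity
  set y : ℕ → Space d := fun m => z m - (γ * h m ^ α) • v m
  have hy : Tendsto y 𝒰 (𝓝 x) := by simpa using hz.sub (hlam.smul hv)
  -- Steps k < k₀ reach back at most r and are estimated by the test function; older ones use
  -- uniform convergence.
  set k₀ : ℕ → ℕ := fun m => ⌊r / h m⌋₊
  have hk₀ : Tendsto (fun m => (k₀ m : ℝ) * h m) 𝒰 (𝓝 r) := tendsto_floor_mul hh hstep hr0.le
  have hk₀' : Tendsto (fun m => ((k₀ m : ℝ) + 1) * h m) 𝒰 (𝓝 r) := by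
    simpa [add_mul] using hk₀.add hstep
  have hk₀r : ∀ m, (k₀ m : ℝ) * h m ≤ r := fun m => by
    have := Nat.floor_le (div_nonneg hr0.le (hh m).le)
    rwa [le_div_iff₀ (hh m)] at this
  have hk₀r' : ∀ m, r ≤ ((k₀ m : ℝ) + 1) * h m := fun m => by
    have := Nat.lt_floor_add_one (r / h m)
    rw [div_lt_iff₀ (hh m)] at this
    exact this.le
  have hk₀n : ∀ᶠ m in 𝒰, ((k₀ m : ℝ) + 1) * h m < ((n m : ℝ) + 1) * h m :=
    hk₀'.eventually_lt hn' hrt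
  set w : ℝ → ℝ := fun τ => - caputoIntegrand α (fun s => u s x) t τ + ε' * (1 / τ ^ (α + 1))
  have hucont : ContinuousOn (fun s => u s x) (Icc 0 t) :=
    (hu.continuousOn_time x).mono (Icc_subset_Icc_right htT)
  have hpowcont : ContinuousOn (fun τ : ℝ => 1 / τ ^ (α + 1)) (Icc r t) :=
    continuousOn_const.div (continuousOn_id.rpow_const fun τ hτ => Or.inl (hr0.trans_le hτ.1).ne')
      fun τ hτ => (Real.rpow_pos_of_pos (hr0.trans_le hτ.1) _).ne'
  have hcapcont : ContinuousOn (caputoIntegrand α (fun s => u s x) t) (Icc r t) :=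
    (continuousOn_caputoIntegrand hucont).mono fun τ hτ => ⟨hr0.trans_le hτ.1, hτ.2⟩
  have hw : ContinuousOn w (Icc r t) := hcapcont.neg.add (continuousOn_const.mul hpowcont)
  have hmain : ∀ᶠ m in 𝒰, 0 ≤ C * (α * ((((k₀ m : ℝ) + 1) * h m) ^ (1 - α) / (1 - α))) +
      γ * (-inner ℝ g (v m) + ε * B) * (1 - caputoKernel α (k₀ m)) +
      α * (∫ τ in ((k₀ m : ℝ) + 1) * h m..((n m : ℝ) + 1) * h m, w τ) +
      (((n m : ℝ) + 1) * h m) ^ (-α) * (U m 0 (y m) - U m (n m + 1) (z m)) := by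
    have b1 : ∀ᶠ m in 𝒰, ‖v m‖ < B := hv.norm.eventually (gt_mem_nhds (by simp [B]))
    have b2 : ∀ᶠ m in 𝒰, dist (z m) x < min δ ρ :=
      hz.eventually (Metric.ball_mem_nhds x (lt_min hδ hρ))
    have b3 : ∀ᶠ m in 𝒰, dist (y m) x < min δ ρ :=
      hy.eventually (Metric.ball_mem_nhds x (lt_min hδ hρ))
    have b4 : ∀ᶠ m in 𝒰, t - (δ - r) < (n m + 1 : ℕ) * h m :=
      hn.eventually (lt_mem_nhds (by linarith))
    have b5 : ∀ᶠ m in 𝒰, a + r < (n m + 1 : ℕ) * h m :=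
      hn.eventually (lt_mem_nhds (by linarith))
    filter_upwards [hnle, hnt, hNn, hNz, hk₀n, b1, b2, b3, b4, b5,
      hu.eventually_past_le hT h𝒰 htT hn hnt hy hz hε'] with m c1 c2 c3 c4 c5 d1 d2 d3 d4 d5 hpast
    have hkn : k₀ m ≤ n m := by
      have := lt_of_mul_lt_mul_right c5 (hh m).le
      have : (k₀ m : ℝ) < n m := by linarith
      exact_mod_cast this.le
    refine scheme_step_inequality hα₀ hα₁ (hh m) hkn (V := fun k => U m k (y m))
      (hu.step m (n m) c1 (z m)) hC (fun k hk => ?_)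
      (hw.mono (Icc_subset_Icc (hk₀r' m) (by exact_mod_cast c2))) (fun k hk τ hτ => ?_)
    · have hk1 : (k : ℝ) + 1 ≤ k₀ m := by exact_mod_cast hk
      have hσ : ((k : ℝ) + 1) * h m ≤ r :=
        (mul_le_mul_of_nonneg_right hk1 (hh m).le).trans (hk₀r m)
      have hσ0 : 0 < ((k : ℝ) + 1) * h m := by have := hh m; positivity
      have e : ((n m - k : ℕ) : ℝ) * h m = (n m + 1 : ℕ) * h m - ((k : ℝ) + 1) * h m := by
        rw [Nat.cast_sub (hk.le.trans hkn)]; push_cast; ring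
      -- Maximality at (N m, z m), tested at the foot y m at an earlier time, bounds increments of U
      -- by increments of the penalized test function.
      have f1 := c4.2.2 (n m - k) (y m) (by rw [e]; linarith) (by rw [e]; linarith)
        (Metric.mem_closedBall.2 (d3.le.trans (min_le_right _ _)))
      rw [c3, e] at f1
      have f2 := hexp ((n m + 1 : ℕ) * h m) ⟨hnpos m, c2.trans htT⟩ (((k : ℝ) + 1) * h m) hσ0.le
        (by linarith) (by rw [abs_lt]; constructor <;> linarith)
        (by rw [abs_lt]; constructor <;> linarith) (z m) (v m) (γ * h m ^ α) (hlam0 m)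
        (d2.trans_le (min_le_left _ _)) (d3.trans_le (min_le_left _ _))
      have f3 : γ * h m ^ α * (-inner ℝ g (v m) + ε * ‖v m‖) ≤
          γ * h m ^ α * (-inner ℝ g (v m) + ε * B) := by
        refine mul_le_mul_of_nonneg_left ?_ (hlam0 m)
        have := mul_le_mul_of_nonneg_left d1.le hε.le
        linarith
      linarith
    · have hτ0 : 0 < τ := lt_of_lt_of_le (by have := hh m; positivity) hτ.1
      have hp := Real.rpow_pos_of_pos hτ0 (α + 1)
      have := hpast k (Finset.mem_Ico.1 hk).2 τ hτ
      simp only [w, caputoIntegrand]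
      rw [← neg_div, mul_one_div, ← add_div]
      refine div_le_div_of_nonneg_right ?_ hp.le
      linarith
  -- The recent steps have total weight 1 - a (k₀) → 1, so for every fixed r the gradient term
  -- survives with full coefficient.
  have hk₀top : Tendsto (fun m => caputoKernel α (k₀ m)) 𝒰 (𝓝 0) := by
    have h1 : Tendsto (fun m => h m ^ α * (((k₀ m : ℝ) + 1) * h m) ^ (-α)) 𝒰 (𝓝 (0 * r ^ (-α))) := by
      refine Tendsto.mul ?_ (hk₀'.rpow_const (Or.inl hr0.ne'))
      simpa [Real.zero_rpow hα₀.ne'] using hstep.rpow_const (p := α) (Or.inr hα₀.le)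
    rw [zero_mul] at h1
    refine h1.congr fun m => ?_
    rw [Real.mul_rpow (by positivity) (hh m).le, mul_left_comm, ← Real.rpow_add (hh m)]
    simp [caputoKernel]
  have hlim : Tendsto (fun m => C * (α * ((((k₀ m : ℝ) + 1) * h m) ^ (1 - α) / (1 - α))) +
      γ * (-inner ℝ g (v m) + ε * B) * (1 - caputoKernel α (k₀ m)) +
      α * (∫ τ in ((k₀ m : ℝ) + 1) * h m..((n m : ℝ) + 1) * h m, w τ) +
      (((n m : ℝ) + 1) * h m) ^ (-α) * (U m 0 (y m) - U m (n m + 1) (z m))) 𝒰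
      (𝓝 (C * (α * (r ^ (1 - α) / (1 - α))) + γ * (-inner ℝ g (b t x) + ε * B) * (1 - 0) +
        α * (∫ τ in r..t, w τ) + t ^ (-α) * (u 0 x - u t x))) := by
    refine Tendsto.add (Tendsto.add (Tendsto.add ?_ ?_) ?_) ?_
    · exact (((hk₀'.rpow_const (Or.inl hr0.ne')).div_const _).const_mul _).const_mul _
    · exact (((tendsto_const_nhds.inner hv).neg.add_const _).const_mul _).mul
        (hk₀top.const_sub 1)
    · refine Tendsto.const_mul _ (tendsto_intervalIntegral_endpoints hrt.le hw ?_ ?_ hk₀' hn')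
      · filter_upwards [hk₀n, hnt] with m h1 h2
        push_cast at h2
        exact ⟨hk₀r' m, h1.le.trans h2⟩
      · filter_upwards [hk₀n, hnt] with m h1 h2
        push_cast at h2
        exact ⟨(hk₀r' m).trans h1.le, h2⟩
    · refine (hn'.rpow_const (Or.inl ht0.ne')).mul (Tendsto.sub ?_ ?_)
      · exact hu.tendsto (fun _ => 0) y 0 x (Eventually.of_forall fun m => Nat.zero_le _)
          (by simp) hy
      · exact hu.tendsto (fun m => n m + 1) z t x hnle hn hz
  have hfin := ge_of_tendsto hlim hmain
  have hwint : ∫ τ in r..t, w τ =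
      - (∫ τ in r..t, caputoIntegrand α (fun s => u s x) t τ) + ε' * I := by
    have i1 := (hcapcont.intervalIntegrable_of_Icc (μ := volume) hrt.le).neg
    have i2 := (hpowcont.intervalIntegrable_of_Icc (μ := volume) hrt.le).const_mul ε'
    have := intervalIntegral.integral_add i1 i2
    rw [intervalIntegral.integral_const_mul] at this
    simp only [Pi.neg_apply, intervalIntegral.integral_neg] at this
    exact this
  rw [hwint, Real.rpow_neg ht0.le] at hfin
  have hsmall : α / γ * (ε' * I) ≤ η / 3 := by
    have h1 : α / γ * (ε' * I) ≤ ε' * (α / γ * |I| + 1) := by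
      have h2 : α / γ * I ≤ α / γ * |I| := mul_le_mul_of_nonneg_left (le_abs_self I) hαγ.le
      have h3 := mul_le_mul_of_nonneg_left h2 hε'.le
      linarith
    refine h1.trans (le_of_eq ?_)
    have : α / γ * |I| + 1 ≠ 0 := by positivity
    simp only [ε']; field_simp
  have hεB : ε * B = η / 3 := by simp only [ε]; field_simp
  have hK : K α r (fun s => u s x) t = (t ^ α)⁻¹ * (u t x - u 0 x) / γ +
      α / γ * ∫ τ in r..t, caputoIntegrand α (fun s => u s x) t τ := by
    rw [K]; simp only [γ]; congr 1; rw [div_mul_eq_div_div]; ring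
  rw [hK, real_inner_comm]
  set Q := ∫ τ in r..t, caputoIntegrand α (fun s => u s x) t τ
  have hdiv := div_nonneg hfin hγ.le
  have e : (C * (α * (r ^ (1 - α) / (1 - α))) + γ * (-inner ℝ g (b t x) + ε * B) * (1 - 0) +
      α * (-Q + ε' * I) + (t ^ α)⁻¹ * (u 0 x - u t x)) / γ =
      C / γ * (α * (r ^ (1 - α) / (1 - α))) - inner ℝ g (b t x) + ε * B - α / γ * Q +
      α / γ * (ε' * I) - (t ^ α)⁻¹ * (u t x - u 0 x) / γ := by
    field_simp; ring
  rw [e] at hdiv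
  linarith

theorem IsSchemeLimit.isViscositySubsolution (hα₀ : 0 < α) (hα₁ : α < 1) (hT : 0 < T)
    (h𝒰 : (𝒰 : Filter ℕ) ≤ atTop)
    (hb : ContinuousOn (Function.uncurry b) (closedCylinder d T))
    (hu : IsSchemeLimit α T b 𝒰 U u) (hper : ∀ t ∈ Icc 0 T, IsTorusPeriodic (u t)) :
    IsViscositySubsolution α T (transportHamiltonian b) u where
  periodic := hper
  upperSemicontinuousOn := hu.continuousOn.upperSemicontinuousOn
  test a b' ha hb' hab c ρ hρ φ hφ t ht x hx hmax := by
    have ht0 : 0 < t := ha.1.trans_lt ht.1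
    have htT : t ≤ T := ht.2.trans hb'.2
    have hucont : ContinuousOn (fun s => u s x) (Icc 0 t) :=
      (hu.continuousOn_time x).mono (Icc_subset_Icc_right htT)
    refine ⟨intervalIntegrable_caputoIntegrand hucont (sub_pos.2 ht.1) (by linarith [ha.1]) le_rfl,
      ?_⟩
    obtain ⟨C, hC⟩ := hφ.exists_abs_sub_le ⟨ht0, htT⟩ x
    -- The maximum is localized to a ball centred at x and to times up to t.
    have hxρ : 0 < ρ - dist x c := sub_pos.2 hx
    have key := J_add_K_le hα₀ hα₁ hucont
      ((hφ.continuousOn_time x).mono (Icc_subset_Icc_right htT)) hC (sub_pos.2 ht.1)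
      (by linarith [ha.1]) (c := -inner ℝ (b t x) (gradient (φ t) x)) (fun τ hτ => by
        have := hmax (t - τ) ⟨by linarith [hτ.2], by linarith [hτ.1, ht.2]⟩ x
          (Metric.ball_subset_closedBall hx)
        linarith) (fun η hη => hu.eventually_K_le hα₀ hα₁ hT h𝒰 hb hφ ha.1 ht.1 htT hxρ
          (fun s hs y hy => hmax s ⟨hs.1, hs.2.trans ht.2⟩ y (by
            rw [Metric.mem_closedBall] at hy ⊢
            linarith [dist_triangle y x c])) hη)
    rw [transportHamiltonian]
    linarith

end

/-! ### Uniform estimates for the transport scheme and existence of the limit. -/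

theorem exists_compact_fundamental_domain (d : ℕ) : ∃ s : Set (Space d), IsCompact s ∧
    ∀ x : Space d, ∃ z : Fin d → ℤ, x + WithLp.toLp 2 (fun i => (z i : ℝ)) ∈ s := by
  refine ⟨WithLp.toLp 2 '' Icc (0 : Fin d → ℝ) 1,
    isCompact_Icc.image (PiLp.continuous_toLp 2 _), fun x => ⟨fun i => -⌊x i⌋, ?_⟩⟩
  refine ⟨fun i => Int.fract (x i), ⟨fun i => Int.fract_nonneg _, fun i => (Int.fract_lt_one _).le⟩,
    ?_⟩
  ext i
  simp [Int.fract, sub_eq_add_neg]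

theorem exists_norm_le_of_periodic {d : ℕ} {T : ℝ} {F : Type*} [SeminormedAddCommGroup F]
    {f : ℝ → Space d → F} (hper : ∀ t ∈ Icc 0 T, IsTorusPeriodic (f t))
    (hcont : ContinuousOn (Function.uncurry f) (closedCylinder d T)) :
    ∃ B, 0 ≤ B ∧ ∀ t ∈ Icc 0 T, ∀ x, ‖f t x‖ ≤ B := by
  obtain ⟨s, hs, hz⟩ := exists_compact_fundamental_domain d
  obtain ⟨B, hB⟩ := ((isCompact_Icc (a := (0 : ℝ)) (b := T)).prod hs).exists_bound_of_continuousOn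
    (hcont.mono (prod_mono_right (subset_univ s)))
  refine ⟨max B 0, le_max_right _ _, fun t ht x => ?_⟩
  obtain ⟨z, hzx⟩ := hz x
  have := hB (t, x + WithLp.toLp 2 (fun i => (z i : ℝ))) ⟨ht, hzx⟩
  rw [Function.uncurry_apply_pair, hper t ht] at this
  exact this.trans (le_max_left _ _)

section concrete
variable {d : ℕ} {α T : ℝ} {b : ℝ → Space d → Space d} {u₀ : Space d → ℝ} {C₁ C₂ : ℝ}

/-- The discrete solution with `m + 1` time steps. -/
noncomputable def discreteSolution (α T : ℝ) (b : ℝ → Space d → Space d) (u₀ : Space d → ℝ)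
    (m : ℕ) : ℕ → Space d → ℝ :=
  scheme (caputoKernel α) 1 (foot α (fun t => b (min t T)) (timeStep T m)) u₀

/-- The Lipschitz constants of the discrete solution. -/
noncomputable def discreteLipschitz (α T C₁ C₂ : ℝ) (m n : ℕ) : ℝ :=
  scheme (caputoKernel α) (1 + Real.Gamma (1 - α) * timeStep T m ^ α * C₁) (fun _ => id)
    (fun _ : Unit => C₂) n ()

theorem min_timeStep_mem (hT : 0 < T) (m n : ℕ) :
    min (((n + 1 : ℕ) : ℝ) * timeStep T m) T ∈ Ioc 0 T :=
  ⟨lt_min (by have := timeStep_pos hT m; positivity) hT, min_le_right _ _⟩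

theorem eventually_discreteLipschitz_le (hα₀ : 0 < α) (hα₁ : α < 1) (hT : 0 < T) (hC₁ : 0 < C₁)
    (hC₂ : 0 < C₂) : ∃ L, 0 ≤ L ∧ ∀ᶠ m in atTop, ∀ n ≤ m + 1, discreteLipschitz α T C₁ C₂ m n ≤ L := by
  set γ := Real.Gamma (1 - α)
  have hγ : 0 < γ := Real.Gamma_pos_of_pos (by linarith)
  -- Chosen so that γ * C₁ * τ₀ ^ α = 1/4, the smallness `growth_le` needs over N ≈ τ₀/h steps; the
  -- bound doubles over each such block.
  set τ₀ := (1 / (4 * γ * C₁)) ^ (α⁻¹)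
  have hτ₀ : 0 < τ₀ := by positivity
  have hτα : τ₀ ^ α = 1 / (4 * γ * C₁) := Real.rpow_inv_rpow (by positivity) hα₀.ne'
  have hhalf : (0 : ℝ) < (1 / 2) ^ (2 * T / τ₀) := by positivity
  refine ⟨2 * C₂ / (1 / 2) ^ (2 * T / τ₀), by positivity, ?_⟩
  filter_upwards [(tendsto_timeStep T).eventually (gt_mem_nhds hτ₀)] with m hm n hn
  have hh := timeStep_pos hT m
  set h := timeStep T m
  set N := ⌊τ₀ / h⌋₊
  have hN1 : 1 ≤ N := Nat.le_floor (by rw [Nat.cast_one, one_le_div hh]; exact hm.le)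
  have hN1' : (1 : ℝ) ≤ N := by exact_mod_cast hN1
  have hNle : (N : ℝ) * h ≤ τ₀ := by
    have := Nat.floor_le (div_nonneg hτ₀.le hh.le)
    rwa [le_div_iff₀ hh] at this
  -- Rounding down loses at most a factor 2 because N ≥ 1; hence the exponent 2 * T / τ₀.
  have hNge : τ₀ ≤ 2 * (N * h) := by
    have := Nat.lt_floor_add_one (τ₀ / h)
    rw [div_lt_iff₀ hh] at this
    have h2 : ((N : ℝ) + 1) * h ≤ 2 * N * h := mul_le_mul_of_nonneg_right (by linarith) hh.le
    linarith
  have hκ : γ * h ^ α * C₁ * ∑ i ∈ Finset.range N, resolvent (caputoKernel α) i ≤ 1 / 4 := by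
    calc _ ≤ γ * h ^ α * C₁ * (N : ℝ) ^ α := by
          gcongr; exact sum_resolvent_caputoKernel_le hα₀ N
      _ = γ * C₁ * (N * h) ^ α := by rw [Real.mul_rpow (by positivity) hh.le]; ring
      _ ≤ γ * C₁ * τ₀ ^ α := by gcongr
      _ = 1 / 4 := by rw [hτα]; field_simp
  set z : ℝ := (1 / 2) ^ ((N : ℝ)⁻¹)
  have hz0 : 0 < z := by positivity
  have hz1 : z ≤ 1 := Real.rpow_le_one (by norm_num) (by norm_num) (by positivity)
  have hzN : z ^ N ≤ 1 / 2 := (Real.rpow_inv_natCast_pow (by norm_num) (by omega)).le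
  have key := growth_le (isMemoryKernel_caputoKernel hα₀) (κ := γ * h ^ α * C₁) (by positivity)
    (X := fun n => discreteLipschitz α T C₁ C₂ m n)
    (by simp [discreteLipschitz, scheme_zero, hC₂.le])
    (fun n => by simp only [discreteLipschitz, scheme_succ, id]; rfl) hκ hz0 hz1 hzN n
  have h0 : discreteLipschitz α T C₁ C₂ m 0 = C₂ := by simp [discreteLipschitz, scheme_zero]
  simp only [h0] at key
  rw [← le_div_iff₀ (by positivity)] at key
  refine key.trans (div_le_div_of_nonneg_left (by positivity) hhalf ?_)
  rw [← Real.rpow_natCast, ← Real.rpow_mul (by norm_num)]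
  refine Real.rpow_le_rpow_of_exponent_ge (by norm_num) (by norm_num) ?_
  have hnT := (mul_timeStep_le_iff hT m n).2 hn
  rw [inv_mul_eq_div, div_le_div_iff₀ (by positivity) hτ₀]
  have h3 : (n : ℝ) * τ₀ ≤ n * (2 * (N * h)) := by gcongr
  have h4 : ((n : ℝ) * h) * (2 * N) ≤ T * (2 * N) := by gcongr
  linarith

variable (hα₀ : 0 < α) (hα₁ : α < 1) (hT : 0 < T)
    (hb_periodic : ∀ t ∈ Icc 0 T, IsTorusPeriodic (b t))
    (hb_cont : ContinuousOn (Function.uncurry b) (closedCylinder d T))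
    (hu₀_periodic : IsTorusPeriodic u₀) (hC₁ : 0 < C₁) (hC₂ : 0 < C₂)
    (hb_lip : ∀ t ∈ Ioc 0 T, ∀ x y, ‖b t x - b t y‖ ≤ C₁ * ‖x - y‖)
    (hu₀_lip : ∀ x y, |u₀ x - u₀ y| ≤ C₂ * ‖x - y‖)

include hα₀ hα₁ hT hC₁ hC₂ hb_lip hu₀_lip in
theorem discreteSolution_lipschitz (m n : ℕ) (x y : Space d) :
    |discreteSolution α T b u₀ m n x - discreteSolution α T b u₀ m n y| ≤
      discreteLipschitz α T C₁ C₂ m n * ‖x - y‖ := by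
  have hγ : 0 < Real.Gamma (1 - α) := Real.Gamma_pos_of_pos (by linarith)
  have hh := timeStep_pos hT m
  refine (scheme_lipschitz (isMemoryKernel_caputoKernel hα₀) (by positivity) (fun n x y => ?_)
    hu₀_lip hC₂.le n).2 x y
  have h1 := hb_lip _ (min_timeStep_mem hT m n) x y
  set t := min (((n + 1 : ℕ) : ℝ) * timeStep T m) T
  set c := Real.Gamma (1 - α) * timeStep T m ^ α
  have hc : 0 ≤ c := by positivity
  have e : foot α (fun t => b (min t T)) (timeStep T m) (n + 1) x -
      foot α (fun t => b (min t T)) (timeStep T m) (n + 1) y = (x - y) - c • (b t x - b t y) := by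
    simp only [foot, c, t, smul_sub]; abel
  rw [e]
  refine (norm_sub_le _ _).trans ?_
  rw [norm_smul, Real.norm_of_nonneg hc]
  have := mul_le_mul_of_nonneg_left h1 hc
  linarith

include hα₀ hα₁ hT hb_periodic hb_cont hC₁ hC₂ hb_lip hu₀_lip in
-- The displacement of order h^α and the resolvent sum of order (n-k)^α multiply to the α-th power
-- of the elapsed time.
theorem eventually_discreteSolution_holder : ∃ C, 0 < C ∧ ∀ᶠ m in atTop, ∀ n ≤ m + 1, ∀ k ≤ m + 1,
    ∀ x y, |discreteSolution α T b u₀ m n x - discreteSolution α T b u₀ m k y| ≤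
      C * (|n * timeStep T m - k * timeStep T m| ^ α + ‖x - y‖) := by
  have hγ : 0 < Real.Gamma (1 - α) := Real.Gamma_pos_of_pos (by linarith)
  obtain ⟨L, hL0, hL⟩ := eventually_discreteLipschitz_le hα₀ hα₁ hT hC₁ hC₂
  obtain ⟨B, hB0, hB⟩ := exists_norm_le_of_periodic hb_periodic hb_cont
  set γ := Real.Gamma (1 - α)
  refine ⟨L + 2 * (L * (γ * B)) + 1, by positivity, ?_⟩
  filter_upwards [hL] with m hm
  have hh := timeStep_pos hT m
  have hlip : ∀ n ≤ m + 1, ∀ x y, |discreteSolution α T b u₀ m n x -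
      discreteSolution α T b u₀ m n y| ≤ L * ‖x - y‖ := fun n hn x y =>
    (discreteSolution_lipschitz hα₀ hα₁ hT hC₁ hC₂ hb_lip hu₀_lip m n x y).trans
      (mul_le_mul_of_nonneg_right (hm n hn) (norm_nonneg _))
  set h := timeStep T m
  have htime : ∀ n ≤ m + 1, ∀ k ≤ n, ∀ x, |discreteSolution α T b u₀ m n x -
      discreteSolution α T b u₀ m k x| ≤ 2 * (L * (γ * B)) * |n * h - k * h| ^ α := by
    intro n hn k hk x
    have h1 := scheme_time_estimate (isMemoryKernel_caputoKernel hα₀) (ρ := γ * h ^ α * B)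
      (Y := foot α (fun t => b (min t T)) h) (g := u₀) (n := n) (fun j x => by
        have h2 := hB _ ⟨(min_timeStep_mem hT m j).1.le, (min_timeStep_mem hT m j).2⟩ x
        rw [foot, sub_sub_cancel_left, norm_neg, norm_smul, Real.norm_of_nonneg (by positivity)]
        exact mul_le_mul_of_nonneg_left h2 (by positivity)) hL0
      (fun j hj => hlip j (hj.trans hn)) hk x
    refine h1.trans ?_
    have hsub : (0 : ℝ) ≤ n - k := by rw [sub_nonneg]; exact_mod_cast hk
    calc _ ≤ 2 * (L * (γ * h ^ α * B)) * ((n - k : ℕ) : ℝ) ^ α := by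
          gcongr; exact sum_resolvent_caputoKernel_le hα₀ _
      _ = _ := by
          rw [Nat.cast_sub hk, ← sub_mul, abs_of_nonneg (mul_nonneg hsub hh.le),
            Real.mul_rpow hsub hh.le]
          ring
  have htime' : ∀ n ≤ m + 1, ∀ k ≤ m + 1, ∀ x, |discreteSolution α T b u₀ m n x -
      discreteSolution α T b u₀ m k x| ≤ 2 * (L * (γ * B)) * |n * h - k * h| ^ α := by
    intro n hn k hk x
    rcases le_total k n with h1 | h1
    · exact htime n hn k h1 x
    · rw [abs_sub_comm, abs_sub_comm ((n : ℝ) * h)]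
      exact htime k hk n h1 x
  intro n hn k hk x y
  have h1 := htime' n hn k hk x
  have h2 := hlip k hk x y
  have h3 := abs_sub_le (discreteSolution α T b u₀ m n x) (discreteSolution α T b u₀ m k x)
    (discreteSolution α T b u₀ m k y)
  have h4 : 0 ≤ |(n : ℝ) * h - k * h| ^ α := by positivity
  have h5 := norm_nonneg (x - y)
  have h6 : 0 ≤ 2 * (L * (γ * B)) := by positivity
  nlinarith [mul_nonneg hL0 h4, mul_nonneg h6 h5]

include hb_periodic hu₀_periodic hT in
theorem discreteSolution_periodic (m n : ℕ) :
    IsTorusPeriodic (discreteSolution α T b u₀ m n) := by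
  intro x z
  suffices H : ∀ n x, discreteSolution α T b u₀ m n (x + WithLp.toLp 2 (fun i => (z i : ℝ))) =
    discreteSolution α T b u₀ m n x from H n x
  refine scheme_comp_eq _ _ _ _ (σ := fun x => x + WithLp.toLp 2 (fun i => (z i : ℝ)))
    (fun n x => ?_) (fun x => hu₀_periodic x z)
  have hm : min ((n : ℝ) * timeStep T m) T ∈ Icc 0 T :=
    ⟨le_min (by have := timeStep_pos hT m; positivity) hT.le, min_le_right _ _⟩
  simp only [foot, hb_periodic _ hm x z]
  abel

include hα₀ hα₁ hT hb_periodic hb_cont hC₁ hC₂ hb_lip hu₀_lip hu₀_periodic in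
-- Bounded values converge along the ultrafilter at the indices ⌊t/h⌋, without subsequences; the
-- uniform Hölder bound passes to the limit and upgrades pointwise to continuous convergence.
theorem exists_isSchemeLimit {𝒰 : Ultrafilter ℕ} (h𝒰 : (𝒰 : Filter ℕ) ≤ atTop) :
    ∃ (u : ℝ → Space d → ℝ) (C : ℝ), 0 < C ∧
      IsSchemeLimit α T b 𝒰 (discreteSolution α T b u₀) u ∧
      (∀ t ∈ Icc 0 T, IsTorusPeriodic (u t)) ∧ (∀ x, u 0 x = u₀ x) ∧
      ∀ t ∈ Icc 0 T, ∀ s ∈ Icc 0 T, ∀ x y, |u t x - u s y| ≤ C * (|t - s| ^ α + ‖x - y‖) := by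
  obtain ⟨C, hC, hhol⟩ := eventually_discreteSolution_holder hα₀ hα₁ hT hb_periodic hb_cont hC₁ hC₂
    hb_lip hu₀_lip
  replace hhol := hhol.filter_mono h𝒰
  set U := discreteSolution α T b u₀
  have hstep : Tendsto (timeStep T) 𝒰 (𝓝 0) := (tendsto_timeStep T).mono_left h𝒰
  set κ : ℝ → ℕ → ℕ := fun t m => ⌊t / timeStep T m⌋₊
  have hκlim : ∀ t, 0 ≤ t → Tendsto (fun m => (κ t m : ℝ) * timeStep T m) 𝒰 (𝓝 t) := fun t ht =>
    tendsto_floor_mul (timeStep_pos hT) hstep ht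
  have hκt : ∀ t, 0 ≤ t → ∀ m, (κ t m : ℝ) * timeStep T m ≤ t := fun t ht m => by
    have := Nat.floor_le (div_nonneg ht (timeStep_pos hT m).le)
    rwa [le_div_iff₀ (timeStep_pos hT m)] at this
  have hκle : ∀ t ∈ Icc 0 T, ∀ m, κ t m ≤ m + 1 := fun t ht m =>
    (mul_timeStep_le_iff hT m _).1 ((hκt t ht.1 m).trans ht.2)
  have hex : ∀ t x, ∃ l, t ∈ Icc 0 T → Tendsto (fun m => U m (κ t m) x) 𝒰 (𝓝 l) := by
    intro t x
    by_cases ht : t ∈ Icc 0 T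
    · have hbd : ∀ᶠ m in 𝒰, U m (κ t m) x ∈ Icc (u₀ x - C * T ^ α) (u₀ x + C * T ^ α) := by
        filter_upwards [hhol] with m hm
        have h1 := hm (κ t m) (hκle t ht m) 0 (by omega) x x
        have h2 : |(κ t m : ℝ) * timeStep T m - (0 : ℕ) * timeStep T m| ^ α ≤ T ^ α := by
          refine Real.rpow_le_rpow (abs_nonneg _) ?_ hα₀.le
          rw [Nat.cast_zero, zero_mul, sub_zero, abs_of_nonneg
            (by have := timeStep_pos hT m; positivity)]
          exact (hκt t ht.1 m).trans ht.2
        rw [sub_self, norm_zero, add_zero] at h1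
        have h3 : U m 0 x = u₀ x := by simp only [U, discreteSolution, scheme_zero]
        rw [h3] at h1
        have h4 := abs_le.1 (h1.trans (mul_le_mul_of_nonneg_left h2 hC.le))
        exact ⟨by linarith [h4.1], by linarith [h4.2]⟩
      obtain ⟨l, -, hl⟩ := exists_tendsto_of_eventually_mem_compact isCompact_Icc hbd
      exact ⟨l, fun _ => hl⟩
    · exact ⟨0, fun h => absurd h ht⟩
  choose u hu using hex
  have hholu : ∀ t ∈ Icc 0 T, ∀ s ∈ Icc 0 T, ∀ x y,
      |u t x - u s y| ≤ C * (|t - s| ^ α + ‖x - y‖) := by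
    intro t ht s hs x y
    have l1 := ((hu t x ht).sub (hu s y hs)).abs
    have l2 : Tendsto (fun m => C * (|(κ t m : ℝ) * timeStep T m - κ s m * timeStep T m| ^ α +
        ‖x - y‖)) 𝒰 (𝓝 (C * (|t - s| ^ α + ‖x - y‖))) :=
      (((((hκlim t ht.1).sub (hκlim s hs.1)).abs).rpow_const (Or.inr hα₀.le)).add_const _).const_mul _
    exact le_of_tendsto_of_tendsto l1 l2
      (hhol.mono fun m hm => hm _ (hκle t ht m) _ (hκle s hs m) x y)
  refine ⟨u, C, hC, ⟨fun m n => ?_, fun m n hn x => ?_, fun n x t x₀ hn hnt hx => ?_, ?_⟩,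
    fun t ht x z => ?_, fun x => ?_, hholu⟩
  · refine (LipschitzWith.of_dist_le_mul (K := Real.toNNReal (discreteLipschitz α T C₁ C₂ m n))
      fun x y => ?_).continuous
    rw [Real.dist_eq, dist_eq_norm]
    refine (discreteSolution_lipschitz hα₀ hα₁ hT hC₁ hC₂ hb_lip hu₀_lip m n x y).trans ?_
    exact mul_le_mul_of_nonneg_right (Real.le_coe_toNNReal _) (norm_nonneg _)
  -- The feet use `min t T` so that the bounds on b apply at every index; up to step m + 1 the
  -- truncation is inactive.
  · have h1 : min (((n + 1 : ℕ) : ℝ) * timeStep T m) T = (n + 1 : ℕ) * timeStep T m :=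
      min_eq_left ((mul_timeStep_le_iff hT m (n + 1)).2 hn)
    simp only [U, discreteSolution]
    rw [scheme_succ, one_mul, foot, foot, h1]
  · have ht : t ∈ Icc 0 T := isClosed_Icc.mem_of_tendsto hnt (hn.mono fun m hm =>
      ⟨by have := timeStep_pos hT m; positivity, (mul_timeStep_le_iff hT m _).2 hm⟩)
    have l1 : Tendsto (fun m => C * (|(n m : ℝ) * timeStep T m - κ t m * timeStep T m| ^ α +
        ‖x m - x₀‖)) 𝒰 (𝓝 (C * (|t - t| ^ α + ‖x₀ - x₀‖))) :=
      ((((hnt.sub (hκlim t ht.1)).abs).rpow_const (Or.inr hα₀.le)).add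
        (hx.sub_const x₀).norm).const_mul _
    rw [sub_self, sub_self, abs_zero, norm_zero, Real.zero_rpow hα₀.ne', add_zero, mul_zero] at l1
    have l2 : Tendsto (fun m => U m (n m) (x m) - U m (κ t m) x₀) 𝒰 (𝓝 0) :=
      squeeze_zero_norm' ((hhol.and hn).mono fun m hm => hm.1 _ hm.2 _ (hκle t ht m) _ _) l1
    simpa using l2.add (hu t x₀ ht)
  · rintro ⟨t, x⟩ ⟨ht, -⟩
    have l1 : Tendsto (fun p : ℝ × Space d => C * (|p.1 - t| ^ α + ‖p.2 - x‖))
        (𝓝[closedCylinder d T] (t, x)) (𝓝 0) := by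
      have : Continuous (fun p : ℝ × Space d => C * (|p.1 - t| ^ α + ‖p.2 - x‖)) :=
        continuous_const.mul (((continuous_fst.sub continuous_const).abs.rpow_const
          fun _ => Or.inr hα₀.le).add (continuous_snd.sub continuous_const).norm)
      have h0 := (this.tendsto (t, x)).mono_left (nhdsWithin_le_nhds (s := closedCylinder d T))
      simpa [Real.zero_rpow hα₀.ne'] using h0
    have l2 : Tendsto (fun p : ℝ × Space d => Function.uncurry u p - u t x)
        (𝓝[closedCylinder d T] (t, x)) (𝓝 0) := by
      refine squeeze_zero_norm' ?_ l1
      filter_upwards [self_mem_nhdsWithin] with p hp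
      exact hholu p.1 hp.1 t ht p.2 x
    have := l2.add_const (u t x)
    simpa [ContinuousWithinAt] using this
  · refine tendsto_nhds_unique (hu t _ ht) ((hu t x ht).congr fun m => ?_)
    exact (discreteSolution_periodic hT hb_periodic hu₀_periodic m _ x z).symm
  · have h0 := hu 0 x ⟨le_rfl, hT.le⟩
    simp only [κ, zero_div, Nat.floor_zero, U, discreteSolution, scheme_zero] at h0
    exact tendsto_nhds_unique h0 tendsto_const_nhds

end concrete

/-! ### Change of sign: from subsolutions to supersolutions. -/

section neg
variable {d : ℕ} {α T : ℝ}

theorem caputoIntegrand_neg (f : ℝ → ℝ) (t : ℝ) :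
    caputoIntegrand α (fun s => -f s) t = fun τ => -caputoIntegrand α f t τ := by
  funext τ; simp only [caputoIntegrand]; ring

theorem J_neg (r : ℝ) (f : ℝ → ℝ) (t : ℝ) : J α r (fun s => -f s) t = -J α r f t := by
  simp only [J, caputoIntegrand_neg, intervalIntegral.integral_neg]; ring

theorem K_neg (r : ℝ) (f : ℝ → ℝ) (t : ℝ) : K α r (fun s => -f s) t = -K α r f t := by
  simp only [K, caputoIntegrand_neg, intervalIntegral.integral_neg]; ring

theorem IsTestFunction.neg {φ : ℝ → Space d → ℝ} (hφ : IsTestFunction T φ) :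
    IsTestFunction T (fun t x => -φ t x) where
  continuousOn := hφ.continuousOn.neg
  contDiffOn := hφ.contDiffOn.neg
  integrableOn x := by
    have : (deriv fun t => -φ t x) = -deriv fun t => φ t x := by
      funext t; exact deriv.fun_neg
    rw [this]; exact (hφ.integrableOn x).neg

theorem gradient_neg (f : Space d → ℝ) (x : Space d) :
    gradient (fun y => -f y) x = -gradient f x := by
  rw [gradient, gradient, fderiv_fun_neg, map_neg]

theorem IsTorusPeriodic.neg {f : Space d → ℝ} (hf : IsTorusPeriodic f) :
    IsTorusPeriodic fun x => -f x := fun x z => congrArg Neg.neg (hf x z)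

variable {b : ℝ → Space d → Space d} {u : ℝ → Space d → ℝ}

theorem transportHamiltonian_neg (t : ℝ) (x : Space d) (r r' : ℝ) (p : Space d) :
    transportHamiltonian b t x r (-p) = -transportHamiltonian b t x r' p := by
  simp only [transportHamiltonian, inner_neg_right]

/-- J and K are linear and the Hamiltonian is odd in the gradient, so a sign change exchanges the
two notions. -/
theorem IsViscositySubsolution.neg (hu : IsViscositySubsolution α T (transportHamiltonian b) u) :
    IsViscositySupersolution α T (transportHamiltonian b) (fun t x => -u t x) where
  periodic t ht := (hu.periodic t ht).neg
  lowerSemicontinuousOn := hu.upperSemicontinuousOn.neg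
  test a b' ha hb' hab c ρ hρ φ hφ t ht x hx hmin := by
    obtain ⟨h1, h2⟩ := hu.test a b' ha hb' hab c ρ hρ _ hφ.neg t ht x hx fun s hs y hy => by
      have := hmin s hs y hy
      linarith
    rw [J_neg, gradient_neg, transportHamiltonian_neg _ _ _ (-u t x)] at h2
    rw [caputoIntegrand_neg, K_neg]
    exact ⟨h1.neg, by linarith⟩

theorem IsViscositySupersolution.neg
    (hu : IsViscositySupersolution α T (transportHamiltonian b) u) :
    IsViscositySubsolution α T (transportHamiltonian b) (fun t x => -u t x) where
  periodic t ht := (hu.periodic t ht).neg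
  upperSemicontinuousOn := hu.lowerSemicontinuousOn.neg
  test a b' ha hb' hab c ρ hρ φ hφ t ht x hx hmax := by
    obtain ⟨h1, h2⟩ := hu.test a b' ha hb' hab c ρ hρ _ hφ.neg t ht x hx fun s hs y hy => by
      have := hmax s hs y hy
      linarith
    rw [J_neg, gradient_neg, transportHamiltonian_neg _ _ _ (-u t x)] at h2
    rw [caputoIntegrand_neg, K_neg]
    exact ⟨h1.neg, by linarith⟩

theorem IsSchemeLimit.neg {𝒰 : Ultrafilter ℕ} {U : ℕ → ℕ → Space d → ℝ}
    (hu : IsSchemeLimit α T b 𝒰 U u) :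
    IsSchemeLimit α T b 𝒰 (fun m n x => -U m n x) (fun t x => -u t x) where
  continuous m n := (hu.continuous m n).neg
  step m n hn x := by
    have := memoryAverage_mul (caputoKernel α)
      (fun k => U m k (foot α b (timeStep T m) (n + 1) x)) (-1) n
    simp only [mul_neg_one] at this
    rw [this, hu.step m n hn x]
  tendsto n x t x₀ hn hnt hx := (hu.tendsto n x t x₀ hn hnt hx).neg
  continuousOn := hu.continuousOn.neg

theorem IsSchemeLimit.isViscositySupersolution {𝒰 : Ultrafilter ℕ} {U : ℕ → ℕ → Space d → ℝ}
    (hα₀ : 0 < α) (hα₁ : α < 1) (hT : 0 < T) (h𝒰 : (𝒰 : Filter ℕ) ≤ atTop)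
    (hb : ContinuousOn (Function.uncurry b) (closedCylinder d T))
    (hu : IsSchemeLimit α T b 𝒰 U u) (hper : ∀ t ∈ Icc 0 T, IsTorusPeriodic (u t)) :
    IsViscositySupersolution α T (transportHamiltonian b) u := by
  simpa using (hu.neg.isViscositySubsolution hα₀ hα₁ hT h𝒰 hb fun t ht => (hper t ht).neg).neg

end neg

/-! ### Doubling of variables and comparison. -/

section paraboloid
variable {d : ℕ}

/-- The quadratic function centred at `(t₀, x₀)`, used to double the variables. -/
noncomputable def paraboloid (ε t₀ : ℝ) (x₀ : Space d) (t : ℝ) (x : Space d) : ℝ :=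
  (‖x - x₀‖ ^ 2 + (t - t₀) ^ 2) / (2 * ε)

theorem contDiff_paraboloid (ε t₀ : ℝ) (x₀ : Space d) :
    ContDiff ℝ 1 (Function.uncurry (paraboloid ε t₀ x₀)) := by
  have : ContDiff ℝ 1 (fun p : ℝ × Space d => (‖p.2 - x₀‖ ^ 2 + (p.1 - t₀) ^ 2) / (2 * ε)) :=
    (((contDiff_snd.sub contDiff_const).norm_sq ℝ).add
      ((contDiff_fst.sub contDiff_const).pow 2)).div_const _
  exact this

theorem isTestFunction_paraboloid (T ε t₀ : ℝ) (x₀ : Space d) :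
    IsTestFunction T (paraboloid ε t₀ x₀) where
  continuousOn := (contDiff_paraboloid ε t₀ x₀).continuous.continuousOn
  contDiffOn := (contDiff_paraboloid ε t₀ x₀).contDiffOn
  integrableOn x := by
    have h1 : ContDiff ℝ 1 (fun t => paraboloid ε t₀ x₀ t x) := by
      unfold paraboloid; fun_prop
    exact ((h1.continuous_deriv le_rfl).integrableOn_Icc (a := 0) (b := T)).mono_set
      Ioo_subset_Icc_self

theorem gradient_paraboloid (ε t₀ t : ℝ) (x₀ x : Space d) :
    gradient (paraboloid ε t₀ x₀ t) x = ε⁻¹ • (x - x₀) := by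
  refine HasGradientAt.gradient ?_
  rw [hasGradientAt_iff_hasFDerivAt]
  have h1 : HasFDerivAt (fun y : Space d => ‖y - x₀‖ ^ 2) (2 • (innerSL ℝ (x - x₀))) x := by
    simpa using ((hasFDerivAt_id x).sub_const x₀).norm_sq
  have h2 := ((h1.add_const ((t - t₀) ^ 2)).const_mul (2 * ε)⁻¹)
  refine (h2.congr_of_eventuallyEq (Eventually.of_forall fun y => ?_)).congr_fderiv ?_
  · simp only [paraboloid]; rw [div_eq_inv_mul]
  · ext v
    simp only [smul_apply, innerSL_apply_apply, InnerProductSpace.toDual_apply_apply,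
      inner_smul_left, smul_eq_mul, nsmul_eq_mul, mul_inv]
    simp only [Nat.cast_ofNat, conj_trivial]
    ring

theorem exists_abs_paraboloid_sub_le (ε t₀ : ℝ) (x₀ x : Space d) {t : ℝ} (ht : 0 < t) :
    ∃ C, ∀ τ ∈ Icc 0 t, |paraboloid ε t₀ x₀ t x - paraboloid ε t₀ x₀ (t - τ) x| ≤ C * τ :=
  (isTestFunction_paraboloid t ε t₀ x₀).exists_abs_sub_le ⟨ht, le_rfl⟩ x

end paraboloid

theorem abs_integral_caputoIntegrand_le {α M μ t : ℝ} (hα : 0 < α) {f : ℝ → ℝ} (hμ : 0 < μ)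
    (hμt : μ ≤ t) (hM : ∀ s ∈ Icc 0 t, |f s| ≤ M) :
    |∫ τ in μ..t, caputoIntegrand α f t τ| ≤ 2 * M / μ ^ (α + 1) * (t - μ) := by
  have h0 : 0 ≤ M := (abs_nonneg _).trans (hM t ⟨hμ.le.trans hμt, le_rfl⟩)
  rw [← abs_of_nonneg (sub_nonneg.2 hμt)]
  refine (Real.norm_eq_abs _).ge.trans
    (intervalIntegral.norm_integral_le_of_norm_le_const fun τ hτ => ?_)
  rw [uIoc_of_le hμt] at hτ
  have hτ0 : 0 < τ := hμ.trans hτ.1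
  rw [caputoIntegrand, norm_div, Real.norm_eq_abs,
    Real.norm_of_nonneg (Real.rpow_nonneg hτ0.le _)]
  refine div_le_div₀ (by positivity) ?_ (by positivity)
    (Real.rpow_le_rpow hμ.le hτ.1.le (by linarith))
  refine (abs_sub _ _).trans ?_
  have h1 := hM t ⟨hμ.le.trans hμt, le_rfl⟩
  have h2 := hM (t - τ) ⟨by linarith [hτ.2], by linarith⟩
  linarith

section comparison
variable {d : ℕ} {α T : ℝ} {b : ℝ → Space d → Space d} {u v : ℝ → Space d → ℝ}

theorem continuousOn_slice (hu : ContinuousOn (Function.uncurry u) (closedCylinder d T))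
    (x : Space d) {t : ℝ} (ht : t ≤ T) : ContinuousOn (fun s => u s x) (Icc 0 t) :=
  hu.comp (f := fun t => (t, x)) (by fun_prop) fun _ hs => ⟨⟨hs.1, hs.2.trans ht⟩, mem_univ x⟩

/-- The doubled functional attains its maximum, near the diagonal if `u` is Lipschitz. -/
theorem exists_doubling_max (hT : 0 < T) (huper : ∀ t ∈ Icc 0 T, IsTorusPeriodic (u t))
    (hvper : ∀ t ∈ Icc 0 T, IsTorusPeriodic (v t))
    (huc : ContinuousOn (Function.uncurry u) (closedCylinder d T))
    (hvc : ContinuousOn (Function.uncurry v) (closedCylinder d T)) {L : ℝ} (hL : 0 ≤ L)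
    (hlip : ∀ t ∈ Icc 0 T, ∀ x y, |u t x - u t y| ≤ L * ‖x - y‖) {S : Set (Space d)}
    (hS : IsCompact S)
    (hSz : ∀ x : Space d, ∃ z : Fin d → ℤ, x + WithLp.toLp 2 (fun i => (z i : ℝ)) ∈ S)
    {ε : ℝ} (hε : 0 < ε) :
    ∃ t ∈ Icc 0 T, ∃ s ∈ Icc 0 T, ∃ x, ∃ y ∈ S, ‖x - y‖ ≤ 2 * L * ε ∧
      ∀ t' ∈ Icc 0 T, ∀ s' ∈ Icc 0 T, ∀ x' y',
        u t' x' - v s' y' - paraboloid ε s' y' t' x' ≤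
          u t x - v s y - paraboloid ε s y t x := by
  set Φ : (ℝ × ℝ) × Space d × Space d → ℝ := fun p =>
    u p.1.1 (p.2.1 + p.2.2) - v p.1.2 p.2.1 - paraboloid ε p.1.2 p.2.1 p.1.1 (p.2.1 + p.2.2)
  -- In the coordinates (y, x - y), a common lattice translation brings y into S without changing
  -- the functional, and x - y is confined to a ball.
  set D : Set ((ℝ × ℝ) × Space d × Space d) :=
    (Icc 0 T ×ˢ Icc 0 T) ×ˢ S ×ˢ Metric.closedBall 0 (2 * L * ε)
  have hD : IsCompact D := (isCompact_Icc.prod isCompact_Icc).prod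
    (hS.prod (isCompact_closedBall _ _))
  have hΦ : ContinuousOn Φ D := by
    refine ContinuousOn.sub (ContinuousOn.sub ?_ ?_) ?_
    · exact huc.comp (f := fun p : (ℝ × ℝ) × Space d × Space d => (p.1.1, p.2.1 + p.2.2))
        (by fun_prop) fun p hp => ⟨hp.1.1, mem_univ _⟩
    · exact hvc.comp (f := fun p : (ℝ × ℝ) × Space d × Space d => (p.1.2, p.2.1))
        (by fun_prop) fun p hp => ⟨hp.1.2, mem_univ _⟩
    · unfold paraboloid
      fun_prop
  obtain ⟨z₀, hz₀⟩ := hSz 0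
  have h0T : (0 : ℝ) ∈ Icc 0 T := ⟨le_rfl, hT.le⟩
  obtain ⟨⟨⟨t, s⟩, y, w⟩, ⟨⟨ht, hs⟩, hy, hw⟩, hmax⟩ := hD.exists_isMaxOn
    ⟨((0, 0), _, 0), ⟨⟨h0T, h0T⟩, hz₀, Metric.mem_closedBall_self (by positivity)⟩⟩ hΦ
  refine ⟨t, ht, s, hs, y + w, y, hy, by simpa using hw, ?_⟩
  have hball : ∀ t' ∈ Icc 0 T, ∀ s' ∈ Icc 0 T, ∀ x' y', ‖x' - y'‖ ≤ 2 * L * ε →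
      u t' x' - v s' y' - paraboloid ε s' y' t' x' ≤
        u t (y + w) - v s y - paraboloid ε s y t (y + w) := by
    intro t' ht' s' hs' x' y' hxy
    obtain ⟨z, hz⟩ := hSz y'
    have h1 := hmax (show ((t', s'), y' + WithLp.toLp 2 (fun i => (z i : ℝ)), x' - y') ∈ D from
      ⟨⟨ht', hs'⟩, hz, by simpa using hxy⟩)
    have e : y' + WithLp.toLp 2 (fun i => (z i : ℝ)) + (x' - y') =
        x' + WithLp.toLp 2 (fun i => (z i : ℝ)) := by abel
    simp only [mem_ofPred_eq, Φ, e, paraboloid, add_sub_add_right_eq_sub] at h1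
    rw [huper t' ht', hvper s' hs'] at h1
    exact h1
  intro t' ht' s' hs' x' y'
  rcases le_or_gt ‖x' - y'‖ (2 * L * ε) with h | h
  · exact hball t' ht' s' hs' x' y' h
  · refine le_trans ?_ (hball t' ht' s' hs' y' y' (by simp; positivity))
    have h1 := (abs_le.1 (hlip t' ht' x' y')).2
    simp only [paraboloid, sub_self, norm_zero]
    -- Outside the ball, moving x' to y' costs u at most L‖x' - y'‖ and saves at least as much
    -- penalty.
    have h2 : L * ‖x' - y'‖ ≤ ‖x' - y'‖ ^ 2 / (2 * ε) := by
      rw [le_div_iff₀ (by positivity)]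
      nlinarith [norm_nonneg (x' - y')]
    rw [add_div]
    have h3 : ((0 : ℝ) ^ 2 + (t' - s') ^ 2) / (2 * ε) = (t' - s') ^ 2 / (2 * ε) := by ring
    rw [h3]
    linarith

/-- The inequality obtained from the equations at a maximum point of the doubled functional. -/
theorem doubling_inequality (hα₀ : 0 < α) (hα₁ : α < 1)
    (hu : IsViscositySubsolution α T (transportHamiltonian b) u)
    (hv : IsViscositySupersolution α T (transportHamiltonian b) v)
    (huc : ContinuousOn (Function.uncurry u) (closedCylinder d T))
    (hvc : ContinuousOn (Function.uncurry v) (closedCylinder d T)) {M : ℝ}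
    (huM : ∀ t ∈ Icc 0 T, ∀ x, |u t x| ≤ M) (hvM : ∀ t ∈ Icc 0 T, ∀ x, |v t x| ≤ M)
    {ε : ℝ} {t s : ℝ} (ht : t ∈ Ioc 0 T) (hs : s ∈ Ioc 0 T) {x y : Space d}
    (hmax : ∀ t' ∈ Icc 0 T, ∀ s' ∈ Icc 0 T, ∀ x' y',
        u t' x' - v s' y' - paraboloid ε s' y' t' x' ≤ u t x - v s y - paraboloid ε s y t x) :
    (u t x - u 0 x) / (t ^ α * Real.Gamma (1 - α)) -
      (v s y - v 0 y) / (s ^ α * Real.Gamma (1 - α)) ≤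
      inner ℝ (b s y - b t x) (ε⁻¹ • (x - y)) +
        α / Real.Gamma (1 - α) * (2 * M / min t s ^ (α + 1) * |t - s|) := by
  have hγ : 0 < Real.Gamma (1 - α) := Real.Gamma_pos_of_pos (by linarith)
  set γ := Real.Gamma (1 - α)
  set μ := min t s
  have hμ : 0 < μ := lt_min ht.1 hs.1
  have hμt : μ ≤ t := min_le_left _ _
  have hμs : μ ≤ s := min_le_right _ _
  have huc' := continuousOn_slice huc x ht.2
  have hvc' := continuousOn_slice hvc y hs.2
  obtain ⟨C, hC⟩ := exists_abs_paraboloid_sub_le ε s y x ht.1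
  obtain ⟨C', hC'⟩ := exists_abs_paraboloid_sub_le ε t x y hs.1
  have hJ1 := tendsto_J_zero hα₀ hα₁ ht.1 (f := fun σ => paraboloid ε s y σ x) hC
  have hJ2 := tendsto_J_zero hα₀ hα₁ hs.1 (f := fun σ => paraboloid ε t x σ y) hC'
  have hsymm : ∀ (t s : ℝ) (x y : Space d), paraboloid ε s y t x = paraboloid ε t x s y :=
    fun t s x y => by simp only [paraboloid]; rw [norm_sub_rev]; ring
  have key : ∀ r ∈ Ioo 0 μ, (u t x - u 0 x) / (t ^ α * γ) - (v s y - v 0 y) / (s ^ α * γ) ≤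
      inner ℝ (b s y - b t x) (ε⁻¹ • (x - y)) + α / γ * (2 * M / μ ^ (α + 1) * |t - s|) -
        (J α r (fun σ => paraboloid ε s y σ x) t + J α r (fun σ => paraboloid ε t x σ y) s) := by
    intro r hr
    have hrt : r < t := hr.2.trans_le hμt
    have hrs : r < s := hr.2.trans_le hμs
    -- On the window [t - r, t] the test function enters only through J_r and its gradient; the
    -- former vanishes as r → 0.
    have hsub := (hu.test (t - r) t ⟨by linarith, by linarith [hr.1, ht.2]⟩ ⟨ht.1.le, ht.2⟩
      (by linarith [hr.1]) x 1 one_pos _ (isTestFunction_paraboloid T ε s y) t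
      ⟨by linarith [hr.1], le_rfl⟩ x (Metric.mem_ball_self one_pos) (fun t' ht' x' _ => by
        have := hmax t' ⟨by linarith [ht'.1], by linarith [ht'.2, ht.2]⟩ s ⟨hs.1.le, hs.2⟩ x' y
        linarith)).2
    have hsup := (hv.test (s - r) s ⟨by linarith, by linarith [hr.1, hs.2]⟩ ⟨hs.1.le, hs.2⟩
      (by linarith [hr.1]) y 1 one_pos _ (isTestFunction_paraboloid T ε t x).neg s
      ⟨by linarith [hr.1], le_rfl⟩ y (Metric.mem_ball_self one_pos) (fun s' hs' y' _ => by
        have := hmax t ⟨ht.1.le, ht.2⟩ s' ⟨by linarith [hs'.1], by linarith [hs'.2, hs.2]⟩ x y'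
        rw [hsymm t s', hsymm t s] at this
        linarith)).2
    rw [sub_sub_cancel] at hsub hsup
    rw [gradient_paraboloid] at hsub
    rw [gradient_neg, gradient_paraboloid, J_neg, ← smul_neg, neg_sub] at hsup
    simp only [transportHamiltonian, K] at hsub hsup
    have iu := intervalIntegrable_caputoIntegrand (α := α) huc' hr.1 hr.2.le hμt
    have iv := intervalIntegrable_caputoIntegrand (α := α) hvc' hr.1 hr.2.le hμs
    have eu := intervalIntegral.integral_add_adjacent_intervals iu
      (intervalIntegrable_caputoIntegrand (α := α) huc' hμ hμt le_rfl)
    have ev := intervalIntegral.integral_add_adjacent_intervals iv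
      (intervalIntegrable_caputoIntegrand (α := α) hvc' hμ hμs le_rfl)
    -- Shifting both times back by τ leaves the penalty unchanged, so maximality compares the
    -- increments of u and v under the same kernel.
    have hmono : ∫ τ in r..μ, caputoIntegrand α (fun σ => v σ y) s τ ≤
        ∫ τ in r..μ, caputoIntegrand α (fun σ => u σ x) t τ := by
      refine intervalIntegral.integral_mono_on hr.2.le iv iu fun τ hτ => ?_
      have hτ0 : 0 < τ := hr.1.trans_le hτ.1
      refine div_le_div_of_nonneg_right ?_ (Real.rpow_nonneg hτ0.le _)
      have := hmax (t - τ) ⟨by linarith [hτ.2], by linarith [ht.2]⟩ (s - τ)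
        ⟨by linarith [hτ.2], by linarith [hs.2]⟩ x y
      simp only [paraboloid, sub_sub_sub_cancel_right] at this
      linarith
    have bu := neg_le_of_abs_le (abs_integral_caputoIntegrand_le hα₀ (f := fun σ => u σ x) hμ hμt
      fun σ hσ => huM σ ⟨hσ.1, hσ.2.trans ht.2⟩ x)
    have bv := le_of_abs_le (abs_integral_caputoIntegrand_le hα₀ (f := fun σ => v σ y) hμ hμs
      fun σ hσ => hvM σ ⟨hσ.1, hσ.2.trans hs.2⟩ y)
    -- Of the leftover intervals [μ, t] and [μ, s], at least one is degenerate.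
    have habs : (t - μ) + (s - μ) = |t - s| := by
      simp only [μ]
      rcases le_total t s with h | h
      · rw [min_eq_left h, abs_of_nonpos (by linarith)]; ring
      · rw [min_eq_right h, abs_of_nonneg (by linarith)]; ring
    have hdiff : -(2 * M / μ ^ (α + 1) * |t - s|) ≤
        (∫ τ in r..t, caputoIntegrand α (fun σ => u σ x) t τ) -
          ∫ τ in r..s, caputoIntegrand α (fun σ => v σ y) s τ := by
      rw [← habs, mul_add]
      linarith
    have hdiff' := mul_le_mul_of_nonneg_left hdiff (div_pos hα₀ hγ).le
    rw [inner_sub_left]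
    simp only [γ] at hdiff' ⊢
    linarith
  refine ge_of_tendsto ?_ (eventually_of_mem (Ioo_mem_nhdsGT hμ) key)
  simpa using tendsto_const_nhds.sub (hJ1.add hJ2)

/-- The comparison principle, for a subsolution that is Lipschitz continuous in space. -/
theorem comparison_of_lipschitz (hα₀ : 0 < α) (hα₁ : α < 1) (hT : 0 < T)
    (hb : ContinuousOn (Function.uncurry b) (closedCylinder d T))
    (hu : IsViscositySubsolution α T (transportHamiltonian b) u)
    (hv : IsViscositySupersolution α T (transportHamiltonian b) v)
    (huc : ContinuousOn (Function.uncurry u) (closedCylinder d T))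
    (hvc : ContinuousOn (Function.uncurry v) (closedCylinder d T)) {L : ℝ} (hL : 0 ≤ L)
    (hlip : ∀ t ∈ Icc 0 T, ∀ x y, |u t x - u t y| ≤ L * ‖x - y‖)
    (h₀ : ∀ x, u 0 x ≤ v 0 x) : ∀ t ∈ Icc 0 T, ∀ x, u t x ≤ v t x := by
  by_contra! hcon
  obtain ⟨t₁, ht₁, x₁, hθ⟩ := hcon
  obtain ⟨Mu, -, hMu⟩ := exists_norm_le_of_periodic hu.periodic huc
  obtain ⟨Mv, -, hMv⟩ := exists_norm_le_of_periodic hv.periodic hvc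
  set M := max Mu Mv
  have huM : ∀ t ∈ Icc 0 T, ∀ x, |u t x| ≤ M := fun t ht x =>
    (hMu t ht x).trans (le_max_left _ _)
  have hvM : ∀ t ∈ Icc 0 T, ∀ x, |v t x| ≤ M := fun t ht x =>
    (hMv t ht x).trans (le_max_right _ _)
  obtain ⟨S, hS, hSz⟩ := exists_compact_fundamental_domain d
  set ε : ℕ → ℝ := timeStep 1
  have hε : ∀ m, 0 < ε m := timeStep_pos one_pos
  choose t ht s hs x y hy hxy hmax using fun m =>
    exists_doubling_max hT hu.periodic hv.periodic huc hvc hL hlip hS hSz (hε m)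
  set 𝒰 := hyperfilter ℕ
  have hε0 : Tendsto ε 𝒰 (𝓝 0) := (tendsto_timeStep 1).mono_left Nat.hyperfilter_le_atTop
  obtain ⟨t₀, ht₀, htlim⟩ := exists_tendsto_of_eventually_mem_compact (𝒰 := 𝒰) isCompact_Icc
    (Eventually.of_forall ht)
  obtain ⟨y₀, -, hylim⟩ := exists_tendsto_of_eventually_mem_compact (𝒰 := 𝒰) hS
    (Eventually.of_forall hy)
  -- Comparing the maximum with the point where s is replaced by t gives (t - s)² ≤ 4Mε.
  have hslim : Tendsto s 𝒰 (𝓝 t₀) := by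
    have h1 : Tendsto (fun m => (t m - s m) ^ 2) 𝒰 (𝓝 0) := by
      refine squeeze_zero (g := fun m => 4 * M * ε m) (fun m => sq_nonneg _) (fun m => ?_)
        (by simpa using hε0.const_mul (4 * M))
      have h2 := hmax m (t m) (ht m) (t m) (ht m) (x m) (y m)
      simp only [paraboloid, sub_self, add_div] at h2
      have h3 := neg_le_of_abs_le (hvM (s m) (hs m) (y m))
      have h4 := le_of_abs_le (hvM (t m) (ht m) (y m))
      have h5 : (t m - s m) ^ 2 / (2 * ε m) ≤ 2 * M := by
        have : ((0 : ℝ) ^ 2) / (2 * ε m) = 0 := by simp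
        linarith
      rw [div_le_iff₀ (by have := hε m; positivity)] at h5
      linarith
    have h2 : Tendsto (fun m => t m - s m) 𝒰 (𝓝 0) := by
      have := h1.sqrt
      simp only [Real.sqrt_sq_eq_abs, Real.sqrt_zero] at this
      exact (tendsto_zero_iff_abs_tendsto_zero _).2 this
    simpa using htlim.sub h2
  have hdlim : Tendsto (fun m => x m - y m) 𝒰 (𝓝 0) :=
    squeeze_zero_norm hxy (by simpa using hε0.const_mul (2 * L))
  have hxlim : Tendsto x 𝒰 (𝓝 y₀) := by simpa using hdlim.add hylim
  have hcomp : ∀ {F : Type} [TopologicalSpace F] {f : ℝ → Space d → F} {p : ℕ → ℝ}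
      {q : ℕ → Space d}, ContinuousOn (Function.uncurry f) (closedCylinder d T) →
      (∀ m, p m ∈ Icc 0 T) → Tendsto p 𝒰 (𝓝 t₀) → Tendsto q 𝒰 (𝓝 y₀) →
      Tendsto (fun m => f (p m) (q m)) 𝒰 (𝓝 (f t₀ y₀)) := by
    intro F _ f p q hf hp h1 h2
    exact (hf (t₀, y₀) ⟨ht₀, mem_univ _⟩).tendsto.comp (tendsto_nhdsWithin_iff.2
      ⟨h1.prodMk_nhds h2, Eventually.of_forall fun m => ⟨hp m, mem_univ _⟩⟩)
  have hulim := hcomp huc ht htlim hxlim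
  have hvlim := hcomp hvc hs hslim hylim
  have hpos : u t₁ x₁ - v t₁ x₁ ≤ u t₀ y₀ - v t₀ y₀ := by
    refine ge_of_tendsto (hulim.sub hvlim) (Eventually.of_forall fun m => ?_)
    have h1 := hmax m t₁ ht₁ t₁ ht₁ x₁ x₁
    have h2 : 0 ≤ paraboloid (ε m) (s m) (y m) (t m) (x m) := by
      have := hε m
      unfold paraboloid; positivity
    have h3 : paraboloid (ε m) t₁ x₁ t₁ x₁ = 0 := by simp [paraboloid]
    linarith
  have ht₀pos : 0 < t₀ := by
    refine lt_of_le_of_ne ht₀.1 fun h => ?_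
    rw [← h] at hpos
    linarith [h₀ y₀]
  have hγ : 0 < Real.Gamma (1 - α) := Real.Gamma_pos_of_pos (by linarith)
  have hu0 : Tendsto (fun m => u 0 (x m)) 𝒰 (𝓝 (u 0 y₀)) :=
    (huc (0, y₀) ⟨⟨le_rfl, hT.le⟩, mem_univ _⟩).tendsto.comp (tendsto_nhdsWithin_iff.2
      ⟨tendsto_const_nhds.prodMk_nhds hxlim,
        Eventually.of_forall fun m => ⟨⟨le_rfl, hT.le⟩, mem_univ _⟩⟩)
  have hv0 : Tendsto (fun m => v 0 (y m)) 𝒰 (𝓝 (v 0 y₀)) :=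
    (hvc (0, y₀) ⟨⟨le_rfl, hT.le⟩, mem_univ _⟩).tendsto.comp (tendsto_nhdsWithin_iff.2
      ⟨tendsto_const_nhds.prodMk_nhds hylim,
        Eventually.of_forall fun m => ⟨⟨le_rfl, hT.le⟩, mem_univ _⟩⟩)
  have hineq : ∀ᶠ m in 𝒰, (u (t m) (x m) - u 0 (x m)) / (t m ^ α * Real.Gamma (1 - α)) -
      (v (s m) (y m) - v 0 (y m)) / (s m ^ α * Real.Gamma (1 - α)) ≤
      ‖b (s m) (y m) - b (t m) (x m)‖ * (2 * L) +
        α / Real.Gamma (1 - α) * (2 * M / min (t m) (s m) ^ (α + 1) * |t m - s m|) := by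
    filter_upwards [htlim.eventually (lt_mem_nhds ht₀pos),
      hslim.eventually (lt_mem_nhds ht₀pos)] with m h1 h2
    refine (doubling_inequality hα₀ hα₁ hu hv huc hvc huM hvM ⟨h1, (ht m).2⟩ ⟨h2, (hs m).2⟩
      (hmax m)).trans (add_le_add_left ?_ _)
    refine (real_inner_le_norm _ _).trans (mul_le_mul_of_nonneg_left ?_ (norm_nonneg _))
    have h3 := hε m
    -- By ‖x - y‖ ≤ 2Lε the penalty gradient is at most 2L, uniformly in ε.
    rw [norm_smul, norm_inv, Real.norm_of_nonneg h3.le, inv_mul_le_iff₀ h3]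
    linarith [hxy m]
  have hL1 : Tendsto (fun m => (u (t m) (x m) - u 0 (x m)) / (t m ^ α * Real.Gamma (1 - α)) -
      (v (s m) (y m) - v 0 (y m)) / (s m ^ α * Real.Gamma (1 - α))) 𝒰
      (𝓝 ((u t₀ y₀ - u 0 y₀) / (t₀ ^ α * Real.Gamma (1 - α)) -
        (v t₀ y₀ - v 0 y₀) / (t₀ ^ α * Real.Gamma (1 - α)))) := by
    have hne : t₀ ^ α * Real.Gamma (1 - α) ≠ 0 := by positivity
    exact ((hulim.sub hu0).div ((htlim.rpow_const (Or.inl ht₀pos.ne')).mul_const _) hne).sub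
      ((hvlim.sub hv0).div ((hslim.rpow_const (Or.inl ht₀pos.ne')).mul_const _) hne)
  have hR1 : Tendsto (fun m => ‖b (s m) (y m) - b (t m) (x m)‖ * (2 * L) +
        α / Real.Gamma (1 - α) * (2 * M / min (t m) (s m) ^ (α + 1) * |t m - s m|)) 𝒰
      (𝓝 (‖b t₀ y₀ - b t₀ y₀‖ * (2 * L) +
        α / Real.Gamma (1 - α) * (2 * M / min t₀ t₀ ^ (α + 1) * |t₀ - t₀|))) := by
    refine (((hcomp hb hs hslim hylim).sub (hcomp hb ht htlim hxlim)).norm.mul_const _).add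
      (Tendsto.const_mul _ (Tendsto.mul ?_ (htlim.sub hslim).abs))
    have h1 : min t₀ t₀ ≠ 0 := by rw [min_self]; exact ht₀pos.ne'
    refine tendsto_const_nhds.div ((htlim.min hslim).rpow_const (Or.inl h1)) ?_
    rw [min_self]; positivity
  -- In the limit u - v at (t₀, y₀) is at most its value at (0, y₀), which is nonpositive: this
  -- contradicts `hpos`.
  have hfin := le_of_tendsto_of_tendsto hL1 hR1 hineq
  rw [sub_self, sub_self, norm_zero, abs_zero, zero_mul, mul_zero, mul_zero, add_zero, ← sub_div,
    div_le_iff₀ (by positivity), zero_mul] at hfin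
  linarith [h₀ y₀]

end comparison

end TimeFractional

/-! ### Conclusion. -/

theorem mainTheorem1 (d : ℕ) (α T : ℝ) (hα₀ : 0 < α) (hα₁ : α < 1) (hT : 0 < T)
    (b : ℝ → TimeFractional.Space d → TimeFractional.Space d)
    (hb_periodic : ∀ t ∈ Set.Icc 0 T, TimeFractional.IsTorusPeriodic (b t))
    (hb_cont : ContinuousOn (Function.uncurry b) (TimeFractional.closedCylinder d T))
    (u₀ : TimeFractional.Space d → ℝ) (hu₀_periodic : TimeFractional.IsTorusPeriodic u₀)
    (C₁ C₂ : ℝ) (hC₁ : 0 < C₁) (hC₂ : 0 < C₂)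
    (hb_lip : ∀ t ∈ Set.Ioc 0 T, ∀ x y, ‖b t x - b t y‖ ≤ C₁ * ‖x - y‖)
    (hu₀_lip : ∀ x y, |u₀ x - u₀ y| ≤ C₂ * ‖x - y‖) :
    (∃ u : ℝ → TimeFractional.Space d → ℝ,
      TimeFractional.IsViscositySolution α T (TimeFractional.transportHamiltonian b) u₀ u) ∧
    (∀ u v : ℝ → TimeFractional.Space d → ℝ,
      TimeFractional.IsViscositySolution α T (TimeFractional.transportHamiltonian b) u₀ u →
      TimeFractional.IsViscositySolution α T (TimeFractional.transportHamiltonian b) u₀ v →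
      ∀ t ∈ Set.Icc 0 T, ∀ x, u t x = v t x) ∧
    (∃ C₃ : ℝ, 0 < C₃ ∧ ∀ u : ℝ → TimeFractional.Space d → ℝ,
      TimeFractional.IsViscositySolution α T (TimeFractional.transportHamiltonian b) u₀ u →
      ∀ t ∈ Set.Icc 0 T, ∀ s ∈ Set.Icc 0 T, ∀ x y,
        |u t x - u s y| ≤ C₃ * (|t - s| ^ α + ‖x - y‖)) := by
  obtain ⟨w, C, hC, hlim, hper, hinit, hhol⟩ :=
    TimeFractional.exists_isSchemeLimit hα₀ hα₁ hT hb_periodic hb_cont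
    hu₀_periodic hC₁ hC₂ hb_lip hu₀_lip (𝒰 := Filter.hyperfilter ℕ) Nat.hyperfilter_le_atTop
  have hsub := hlim.isViscositySubsolution hα₀ hα₁ hT Nat.hyperfilter_le_atTop hb_cont hper
  have hsup := hlim.isViscositySupersolution hα₀ hα₁ hT Nat.hyperfilter_le_atTop hb_cont hper
  have hlip : ∀ t ∈ Set.Icc 0 T, ∀ x y, |w t x - w t y| ≤ C * ‖x - y‖ := fun t ht x y => by
    simpa [Real.zero_rpow hα₀.ne'] using hhol t ht t ht x y
  have heq : ∀ u, TimeFractional.IsViscositySolution α T (TimeFractional.transportHamiltonian b) u₀ u →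
      ∀ t ∈ Set.Icc 0 T, ∀ x, u t x = w t x := by
    intro u hu t ht x
    refine le_antisymm ?_ ?_
    -- Comparison needs the Lipschitz function as the subsolution; for u ≤ w it is applied to -w and
    -- -u.
    · have h := TimeFractional.comparison_of_lipschitz hα₀ hα₁ hT hb_cont hsup.neg
        hu.subsolution.neg hlim.continuousOn.neg hu.continuousOn.neg hC.le (fun t ht x y => by
          rw [neg_sub_neg, abs_sub_comm]; exact hlip t ht x y)
        (fun x => by rw [hinit, hu.initial]) t ht x
      exact neg_le_neg_iff.1 h
    · exact TimeFractional.comparison_of_lipschitz hα₀ hα₁ hT hb_cont hsub hu.supersolution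
        hlim.continuousOn hu.continuousOn hC.le hlip (fun x => by rw [hinit, hu.initial]) t ht x
  refine ⟨⟨w, hlim.continuousOn, hsub, hsup, hinit⟩, fun u v hu hv t ht x => ?_, C, hC,
    fun u hu t ht s hs x y => ?_⟩
  · rw [heq u hu t ht x, heq v hv t ht x]
  · rw [heq u hu t ht x, heq u hu s hs y]
    exact hhol t ht s hs x y
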